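/- Let $\Gamma$ be a group generated by a sequence of elements $c_0,c_1,c_2,\dots$. Let $C=\{c_n,c_n^{-1}\mid n\in\mathbb N\}$, regarded as an infinite set of formal letters, let $C^*$ be the free monoid on $C$, let $A=\{a,b,a^{-1},b^{-1}\}$ be a four-letter alphabet, and let $\nu:C^*\to A^*$ be the monoid homomorphism with $\nu(c_n^{\pm1})=b^na^{\pm1}b^{-n}$. The word problem in $\Gamma$ is said to be solvable in polynomial time (resp. in NP) if there is a deterministic (resp. non-deterministic) Turing machine with input alphabet $A$ that accepts exactly the language $$\{\nu(u)\mid u\in C^*,\ u=1\text{ in }\Gamma\}\subseteq A^*$$ and whose time function is bounded by a polynomial, i.e. there is a polynomial $p$ such that every computation on every input $w$ takes at most $p(|w|)$ steps. For a group $G$ with a finite tuple of generators $g_1,\dots,g_k$, the word problem is solvable in polynomial time (resp. in NP) if such a deterministic (resp. non-deterministic) machine with input alphabet $\{g_1^{\pm1},\dots,g_k^{\pm1}\}$ accepts exactly the words in these letters that represent $1$ in $G$. If the word problem in $\Gamma$ with respect to $c_0,c_1,c_2,\dots$ is solvable in polynomial time (resp. in NP), then $\Gamma$ embeds in a group $G$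 generated by four elements such that the word problem in $G$ with respect to these four generators is solvable in polynomial time (resp. in NP). -/

import Mathlib

universe u

/-- A nondeterministic Turing machine with input alphabet `A`.  The machine is the
nondeterministic version of Mathlib's multi-stack model `Turing.TM2` of Turing machines (a
two-way infinite tape is a pair of stacks): it has finitely many stacks, stack symbols, labels
and internal states, and to every label it assigns a finite list of statements; one step of
a computation executes one statement from the list of the current label.  Each statement is
a bounded sequence of push, pop, peek and branch operations. -/
structure NTM (A : Type) where
  /-- index type of the stacks -/
  K : Type
  [decEqK : DecidableEq K]
  [finiteK : Finite K]
  /-- the alphabet of each stack -/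
  Γ : K → Type
  [finiteΓ : ∀ k, Finite (Γ k)]
  /-- the stack that holds the input -/
  k₀ : K
  /-- the input letters are among the symbols of the input stack -/
  input : A ↪ Γ k₀
  /-- labels of the program -/
  Λ : Type
  [finiteΛ : Finite Λ]
  /-- the label at which the computation starts -/
  main : Λ
  /-- internal states -/
  σ : Type
  [finiteσ : Finite σ]
  /-- the internal state in which the computation starts -/
  start : σ
  /-- the internal states in which halting means acceptance -/
  accepting : Set σ
  /-- the program: for each label the statements that may be executed there -/
  prog : Λ → List (Turing.TM2.Stmt Γ Λ σ)

namespace NTM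

variable {A : Type} (M : NTM A)

instance : DecidableEq M.K := M.decEqK

/-- Configurations: the current label (`none` once the machine has executed `halt`), the internal
state, and the contents of the stacks. -/
abbrev Cfg : Type := Turing.TM2.Cfg M.Γ M.Λ M.σ

/-- The initial configuration on input `w`: the first letter of `w` is on top of the input stack,
and all other stacks are empty. -/
def init (w : List A) : M.Cfg where
  l := some M.main
  var := M.start
  stk := Function.update (fun _ => []) M.k₀ (w.map M.input)

/-- `M.Step c c'`: the machine can pass from `c` to `c'` in one step. -/
def Step (c c' : M.Cfg) : Prop :=
  ∃ l, c.l = some l ∧ ∃ q ∈ M.prog l, c' = Turing.TM2.stepAux q c.var c.stk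

/-- `M.StepsIn n c c'`: some computation of exactly `n` steps leads from `c` to `c'`. -/
inductive StepsIn : ℕ → M.Cfg → M.Cfg → Prop
  | refl (c : M.Cfg) : StepsIn 0 c c
  | tail {n : ℕ} {c c' c'' : M.Cfg} : StepsIn n c c' → M.Step c' c'' → StepsIn (n + 1) c c''

/-- The machine accepts `w` if some computation on `w` halts in an accepting state. -/
def Accepts (w : List A) : Prop :=
  ∃ n c, M.StepsIn n (M.init w) c ∧ c.l = none ∧ c.var ∈ M.accepting

/-- The time function of the machine is bounded by a polynomial: for some polynomial `p`, every
computation on every input `w` has at most `p (|w|)` steps. -/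
def PolyTime : Prop :=
  ∃ p : Polynomial ℕ, ∀ (w : List A) (n : ℕ) (c : M.Cfg),
    M.StepsIn n (M.init w) c → n ≤ p.eval w.length

/-- The machine is deterministic: there is never more than one statement to choose from. -/
def Deterministic : Prop := ∀ l, (M.prog l).length ≤ 1

end NTM

/-- The language is accepted by a deterministic Turing machine with polynomially bounded time
function. -/
def InP {A : Type} (L : Language A) : Prop :=
  ∃ M : NTM A, M.Deterministic ∧ M.PolyTime ∧ ∀ w, M.Accepts w ↔ w ∈ L

/-- The language is accepted by a nondeterministic Turing machine with polynomially bounded time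
function. -/
def InNP {A : Type} (L : Language A) : Prop :=
  ∃ M : NTM A, M.PolyTime ∧ ∀ w, M.Accepts w ↔ w ∈ L

/-- The value in `G` of a word in the letters `x` and `x⁻¹`, `x ∈ X`, where `x` is read as `g x`.
The letter `x` is the pair `(x, true)` and the letter `x⁻¹` is the pair `(x, false)`. -/
def wordValue {X G : Type*} [Group G] (g : X → G) (w : List (X × Bool)) : G :=
  (w.map fun p => if p.2 then g p.1 else (g p.1)⁻¹).prod

/-- The word `bⁿ a^ε b⁻ⁿ` that encodes the letter `c_n^ε`, over the alphabet
`{a, a⁻¹, b, b⁻¹}` with `a = 0` and `b = 1`. -/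
def nuLetter (p : ℕ × Bool) : List (Fin 2 × Bool) :=
  List.replicate p.1 (1, true) ++ [(0, p.2)] ++ List.replicate p.1 (1, false)

/-- The monoid homomorphism `ν` from words in the letters `c_n` and `c_n⁻¹`, `n ∈ ℕ`, to words in
`a`, `a⁻¹`, `b`, `b⁻¹` that sends `c_n^ε` to `bⁿ a^ε b⁻ⁿ`. -/
def nu (u : List (ℕ × Bool)) : List (Fin 2 × Bool) := u.flatMap nuLetter

/-- The word problem of a group with respect to a finite family of generators: the words
in the generators and their inverses that represent `1`. -/
def wordProblem {k : ℕ} {G : Type*} [Group G] (g : Fin k → G) : Language (Fin k × Bool) :=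
  {w : List (Fin k × Bool) | wordValue g w = 1}

/-- The word problem of a group with respect to an infinite sequence of generators, encoded over
a finite alphabet: the words `ν(u)` for which `u` represents `1`. -/
def encodedWordProblem {G : Type*} [Group G] (c : ℕ → G) : Language (Fin 2 × Bool) :=
  {w : List (Fin 2 × Bool) | ∃ u : List (ℕ × Bool), wordValue c u = 1 ∧ w = nu u}

/-! The group `Γ` is realised inside a group of permutations of `ℤ × ℤ × Γ`, read as rows, columns
and fibres. Its four generators are the shift of all rows, the shift of the columns of row `0`, the
reflection of the columns of row `0`, and an involution `twist`, which in each row `± triangular i`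
reflects the columns and multiplies the fibre by `c i` over positive columns and by its inverse over
negative ones. A power of the row shift conjugates the twist so that row `triangular i` becomes row
`0`; composed with the reflection, it fixes every column there and multiplies the fibre by a factor
that depends only on the sign of the column. Such a step function is shift invariant except at the
step, so the commutator with the column shift is multiplication by `(c i)⁻¹` over the columns `0`
and `1` and nothing else (`fibreMul_eq`); in other rows the column shift is trivial, and so is the
commutator. Hence `fibreMul` embeds `Γ`.

To decide whether a word `w` is trivial, a point is followed along it, and the factors picked up in
the fibre are recorded as a word in the `c i` (`Trace`). The word is trivial when, from every start,
row and column return and the recorded word is `1` in `Γ`. Polynomially many starts suffice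
(`Trace.wordValue_eq_one_iff_bounded`). If the column is larger in absolute value than the length of
`w`, only its sign matters. If the row is far out, row `0` is out of reach and the gaps between
triangular numbers let at most one twisted row be met; then only the parity of the number of twists
counts, and this parity is already tested at a nearer row with the same surroundings.

Triangular numbers serve three purposes: their gaps grow, they grow only quadratically, and they are
recognised with boundedly many stack operations. In the two-counter walk `Zigzag` the increasing
counter is empty exactly at triangular times, and the other one then holds the index `i` in unary,
ready for writing `bⁱ a^ε b⁻ⁱ`.

The machine for the overgroup runs through these starts. For each it follows `w`, writes the code of
the recorded word on the input stack of the given machine `M`, checks that the trace closes up, runs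
`M`, and aborts unless `M` accepts. Acceptance is thus a conjunction of queries and never uses a
negative answer of `M`, which is why the argument covers NP; the control structures preserve
determinism, so the same machine covers P. `Program.Spec` does the bookkeeping: running time, the
condition under which some computation halts, and the one memory in which it then halts. -/

/-! ### Zigzag counters and triangular numbers. -/

/-- A zigzag encoding of the natural numbers by a direction and two counters.  The counter that
is being emptied is the first one when the direction is `false` and the second one otherwise. -/
structure Zigzag where
  dir : Bool
  a : ℕ
  b : ℕ

namespace Zigzag

/-- The counter that decreases. -/
def source (z : Zigzag) : ℕ := if z.dir then z.b else z.a

/-- The counter that increases. -/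
def target (z : Zigzag) : ℕ := if z.dir then z.a else z.b

def next : Zigzag → Zigzag
  | ⟨false, 0, b⟩ => ⟨true, 0, b + 1⟩
  | ⟨false, a + 1, b⟩ => ⟨false, a, b + 1⟩
  | ⟨true, a, 0⟩ => ⟨false, a + 1, 0⟩
  | ⟨true, a, b + 1⟩ => ⟨true, a + 1, b⟩

/-- Undoes `next`. The truncated subtractions matter only at states that `next` never reaches. -/
def prev : Zigzag → Zigzag
  | ⟨false, a, b + 1⟩ => ⟨false, a + 1, b⟩
  | ⟨false, a, 0⟩ => ⟨true, a - 1, 0⟩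
  | ⟨true, a + 1, b⟩ => ⟨true, a, b + 1⟩
  | ⟨true, 0, b⟩ => ⟨false, 0, b - 1⟩

theorem prev_next (z : Zigzag) : z.next.prev = z := by
  rcases z with ⟨_ | _, _ | a, _ | b⟩ <;> simp [next, prev]

def ofNat : ℕ → Zigzag
  | 0 => ⟨false, 0, 0⟩
  | k + 1 => (ofNat k).next

theorem prev_ofNat_succ (k : ℕ) : (ofNat (k + 1)).prev = ofNat k := prev_next _

theorem ofNat_eq_zero_iff (k : ℕ) : (ofNat k).a = 0 ∧ (ofNat k).b = 0 ↔ k = 0 := by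
  cases k with
  | zero => simp [ofNat]
  | succ k =>
    rw [ofNat]
    generalize ofNat k = z
    rcases z with ⟨_ | _, _ | a, _ | b⟩ <;> simp [next]

end Zigzag

/-- The triangular number `0 + 1 + ⋯ + i`. -/
def triangular : ℕ → ℕ
  | 0 => 0
  | i + 1 => triangular i + (i + 1)

theorem two_mul_triangular (i : ℕ) : 2 * triangular i = i * (i + 1) := by
  induction i with
  | zero => rfl
  | succ i ih => rw [triangular, mul_add, ih]; ring

theorem le_triangular (i : ℕ) : i ≤ triangular i := by
  cases i with
  | zero => exact le_rfl
  | succ i => rw [triangular]; omega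

theorem triangular_add_le {i k : ℕ} (h : i < k) : triangular i + k ≤ triangular k := by
  induction k with
  | zero => omega
  | succ k ih =>
    rw [triangular]
    rcases Nat.lt_succ_iff_lt_or_eq.mp h with h | rfl
    · have := ih h; omega
    · omega

namespace Zigzag

/-- Sweep number `i` carries `i` units from one counter to the other, one per step, and the turn
after it adds a unit. So sweep `i` starts at time `0 + 1 + ⋯ + i`, and its direction is the parity
of `i`. -/
theorem ofNat_triangular_add (i : ℕ) : ∀ j ≤ i, ofNat (triangular i + j) =
    if i % 2 = 0 then ⟨false, i - j, j⟩ else ⟨true, j, i - j⟩ := by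
  have inner (i : ℕ) (h0 : ofNat (triangular i) =
      if i % 2 = 0 then ⟨false, i, 0⟩ else ⟨true, 0, i⟩) : ∀ j ≤ i, ofNat (triangular i + j) =
      if i % 2 = 0 then ⟨false, i - j, j⟩ else ⟨true, j, i - j⟩ := by
    intro j
    induction j with
    | zero => simpa using h0
    | succ j ih =>
      intro hj
      rw [← add_assoc, ofNat, ih (by omega)]
      obtain ⟨d, rfl⟩ : ∃ d, i = j + 1 + d := ⟨i - (j + 1), by omega⟩
      have e1 : j + 1 + d - j = d + 1 := by omega
      have e2 : j + 1 + d - (j + 1) = d := by omega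
      rw [e1, e2]
      split_ifs <;> rfl
  refine inner i ?_
  induction i with
  | zero => simp [ofNat, triangular]
  | succ i ih =>
    rw [triangular, ← add_assoc, ofNat, inner i ih i le_rfl]
    rcases Nat.mod_two_eq_zero_or_one i with h | h
    · have h' : ¬ (i + 1) % 2 = 0 := by omega
      simp [h, h', next]
    · have h' : (i + 1) % 2 = 0 := by omega
      simp [h, h', next]

theorem exists_triangular_add (k : ℕ) : ∃ i j, j ≤ i ∧ k = triangular i + j := by
  induction k with
  | zero => exact ⟨0, 0, le_rfl, rfl⟩
  | succ k ih =>
    obtain ⟨i, j, hj, rfl⟩ := ih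
    rcases hj.lt_or_eq with h | rfl
    · exact ⟨i, j + 1, h, rfl⟩
    · exact ⟨j + 1, 0, by omega, by rw [triangular]; omega⟩

end Zigzag

/-- The index `i` if `n` is the triangular number of `i` up to sign. -/
def rowIndex (n : ℤ) : Option ℕ :=
  if (Zigzag.ofNat n.natAbs).target = 0 then some (Zigzag.ofNat n.natAbs).source else none

theorem rowIndex_eq_some_iff (n : ℤ) (i : ℕ) : rowIndex n = some i ↔ n.natAbs = triangular i := by
  obtain ⟨i', j, hj, h⟩ := Zigzag.exists_triangular_add n.natAbs
  have key : rowIndex n = if j = 0 then some i' else none := by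
    rw [rowIndex, h, Zigzag.ofNat_triangular_add i' j hj]
    rcases Nat.eq_zero_or_pos j with rfl | h0
    · split_ifs with h1 <;> simp_all [Zigzag.target, Zigzag.source]
    · split_ifs <;> simp_all [Zigzag.target]
  rw [key, h]
  constructor
  · intro h
    split_ifs at h with h0
    simp_all
  · intro h
    -- The blocks from `triangular i` to `triangular i + i` are disjoint, so the block containing
    -- `n.natAbs` determines the index.
    have : i = i' := by
      rcases lt_trichotomy i i' with h1 | h1 | h1
      · have := triangular_add_le h1; omega
      · exact h1
      · have := triangular_add_le h1; omega
    subst this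
    have : j = 0 := by omega
    simp [this]

/-! ### The four permutations and the embedding of `Γ`. -/

section Permutations

variable {Γ : Type u} [Group Γ] (c : ℕ → Γ)

/-- The factor `x`, `1` or `x⁻¹`, according to the sign of `m`. -/
def signFactor (x : Γ) (m : ℤ) : Γ := if 0 < m then x else if m < 0 then x⁻¹ else 1

theorem signFactor_neg_mul (x : Γ) (m : ℤ) : signFactor x (-m) * signFactor x m = 1 := by
  unfold signFactor
  rcases lt_trichotomy m 0 with h | rfl | h
  · simp [h, not_lt.mpr h.le]
  · simp
  · simp [h, not_lt.mpr h.le]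

/-- `(n, m, γ) ↦ (n + 1, m, γ)`. -/
def rowShift (Γ : Type u) : Equiv.Perm (ℤ × ℤ × Γ) where
  toFun x := (x.1 + 1, x.2)
  invFun x := (x.1 - 1, x.2)
  left_inv x := by simp
  right_inv x := by simp

/-- `(0, m, γ) ↦ (0, m + 1, γ)`, with all the points outside row `0` fixed. -/
def columnShift (Γ : Type u) : Equiv.Perm (ℤ × ℤ × Γ) where
  toFun x := if x.1 = 0 then (x.1, x.2.1 + 1, x.2.2) else x
  invFun x := if x.1 = 0 then (x.1, x.2.1 - 1, x.2.2) else x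
  left_inv x := by by_cases h : x.1 = 0 <;> simp [h, Prod.ext_iff]
  right_inv x := by by_cases h : x.1 = 0 <;> simp [h, Prod.ext_iff]

/-- `(0, m, γ) ↦ (0, -m, γ)`, with all the points outside row `0` fixed. -/
def reflection (Γ : Type u) : Equiv.Perm (ℤ × ℤ × Γ) where
  toFun x := if x.1 = 0 then (x.1, -x.2.1, x.2.2) else x
  invFun x := if x.1 = 0 then (x.1, -x.2.1, x.2.2) else x
  left_inv x := by by_cases h : x.1 = 0 <;> simp [h, Prod.ext_iff]
  right_inv x := by by_cases h : x.1 = 0 <;> simp [h, Prod.ext_iff]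

/-- The map underlying `twist`. -/
def twistFun (x : ℤ × ℤ × Γ) : ℤ × ℤ × Γ :=
  match rowIndex x.1 with
  | some i => (x.1, -x.2.1, signFactor (c i) x.2.1 * x.2.2)
  | none => x

theorem twistFun_involutive : Function.Involutive (twistFun c) := by
  intro x
  rcases h : rowIndex x.1 with _ | i
  · simp [twistFun, h]
  · simp [twistFun, h, ← mul_assoc, signFactor_neg_mul]

/-- The involution that acts on each row with index `i` as the reflection of the row, twisted
by `c i`. -/
def twist : Equiv.Perm (ℤ × ℤ × Γ) := (twistFun_involutive c).toPerm

/-- The four permutations that generate the overgroup. -/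
def generatorPerm : Fin 4 → Equiv.Perm (ℤ × ℤ × Γ) :=
  ![rowShift Γ, columnShift Γ, reflection Γ, twist c]

/-- Multiplication by an element of `Γ` in the fibres over `(0, 0)` and `(0, 1)`. -/
def fibreMul : Γ →* Equiv.Perm (ℤ × ℤ × Γ) where
  toFun γ :=
    { toFun x := if x.1 = 0 ∧ (x.2.1 = 0 ∨ x.2.1 = 1) then (x.1, x.2.1, γ * x.2.2) else x
      invFun x := if x.1 = 0 ∧ (x.2.1 = 0 ∨ x.2.1 = 1) then (x.1, x.2.1, γ⁻¹ * x.2.2) else x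
      left_inv x := by
        by_cases h : x.1 = 0 ∧ (x.2.1 = 0 ∨ x.2.1 = 1) <;> simp [h, Prod.ext_iff]
      right_inv x := by
        by_cases h : x.1 = 0 ∧ (x.2.1 = 0 ∨ x.2.1 = 1) <;> simp [h, Prod.ext_iff] }
  map_one' := by ext1 x; simp
  map_mul' γ δ := by
    ext1 x
    by_cases h : x.1 = 0 ∧ (x.2.1 = 0 ∨ x.2.1 = 1) <;> simp [h, mul_assoc]

theorem fibreMul_injective : Function.Injective (fibreMul : Γ →* Equiv.Perm (ℤ × ℤ × Γ)) := by
  intro γ δ h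
  have := Equiv.congr_fun h (0, 0, 1)
  simpa [fibreMul] using this

omit [Group Γ] in
theorem rowShift_pow_apply (k : ℕ) (x : ℤ × ℤ × Γ) : (rowShift Γ ^ k) x = (x.1 + k, x.2) := by
  induction k with
  | zero => simp
  | succ k ih =>
    rw [pow_succ', Equiv.Perm.mul_apply, ih]
    simp [rowShift, add_assoc]

omit [Group Γ] in
theorem rowShift_pow_inv_apply (k : ℕ) (x : ℤ × ℤ × Γ) :
    (rowShift Γ ^ k)⁻¹ x = (x.1 - k, x.2) := by
  rw [Equiv.Perm.inv_eq_iff_eq, rowShift_pow_apply]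
  simp

/-- The commutator that isolates the value of the twist on one row. -/
theorem fibreMul_eq (i : ℕ) :
    ((rowShift Γ ^ triangular i)⁻¹ * twist c * rowShift Γ ^ triangular i * reflection Γ) *
      columnShift Γ = fibreMul (c i)⁻¹ * columnShift Γ *
      ((rowShift Γ ^ triangular i)⁻¹ * twist c * rowShift Γ ^ triangular i * reflection Γ) := by
  ext1 x
  obtain ⟨n, m, γ⟩ := x
  simp only [Equiv.Perm.mul_apply]
  by_cases hn : n = 0
  · subst hn
    have h0 : rowIndex (triangular i : ℤ) = some i := by simp [rowIndex_eq_some_iff]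
    have e1 (m : ℤ) (γ : Γ) : columnShift Γ (0, m, γ) = (0, m + 1, γ) := by simp [columnShift]
    have e2 (m : ℤ) (γ : Γ) : reflection Γ (0, m, γ) = (0, -m, γ) := by simp [reflection]
    have e3 (m : ℤ) (γ : Γ) : twist c ((triangular i : ℤ), m, γ) =
        ((triangular i : ℤ), -m, signFactor (c i) m * γ) := by simp [twist, twistFun, h0]
    rw [e1, e2, rowShift_pow_apply, e2, rowShift_pow_apply]
    simp only [zero_add]
    rw [e3, e3, rowShift_pow_inv_apply, rowShift_pow_inv_apply]
    simp only [sub_self]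
    rw [e1]
    simp only [neg_neg, fibreMul, MonoidHom.coe_mk, OneHom.coe_mk, Equiv.coe_fn_mk]
    unfold signFactor
    -- The two sides carry the factors for `-(m + 1)` and `-m`. Their signs differ only when `m` is
    -- `-1` or `0`, that is, when the column after the shift is `0` or `1`; exactly there `fibreMul`
    -- supplies the missing `(c i)⁻¹`.
    rcases lt_trichotomy m (-1) with h | rfl | h
    · have a1 : ¬ (m + 1 = 0 ∨ m + 1 = 1) := by omega
      have a2 : 0 < -(m + 1) := by omega
      have a3 : 0 < -m := by omega
      simp only [a1, a2, a3, and_false, if_true, if_false]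
    · simp
    · rcases (show m = 0 ∨ 0 < m by omega) with rfl | h
      · simp
      · have a1 : ¬ (m + 1 = 0 ∨ m + 1 = 1) := by omega
        have a2 : ¬ 0 < -(m + 1) := by omega
        have a3 : ¬ 0 < -m := by omega
        have a4 : -(m + 1) < 0 := by omega
        have a5 : -m < 0 := by omega
        simp only [a1, a2, a3, a4, a5, and_false, if_true, if_false]
  -- Off row `0` the column shift, the reflection and `fibreMul` are trivial, and the conjugated
  -- twist keeps the row, so both sides reduce to the conjugated twist.
  · have e1 (y : ℤ × Γ) : columnShift Γ (n, y) = (n, y) := by simp [columnShift, hn]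
    have e2 (y : ℤ × Γ) : reflection Γ (n, y) = (n, y) := by simp [reflection, hn]
    have e4 (y : ℤ × Γ) : fibreMul (c i)⁻¹ (n, y) = (n, y) := by simp [fibreMul, hn]
    have e5 (n : ℤ) (y : ℤ × Γ) : ∃ y', twist c (n, y) = (n, y') := by
      rcases h : rowIndex n with _ | j
      · exact ⟨y, by simp [twist, twistFun, h]⟩
      · exact ⟨(-y.1, signFactor (c j) y.1 * y.2), by simp [twist, twistFun, h]⟩
    rw [e1, e2, rowShift_pow_apply]
    obtain ⟨y', hy⟩ := e5 (n + (triangular i : ℕ)) (m, γ)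
    rw [hy, rowShift_pow_inv_apply]
    simp only [add_sub_cancel_right]
    rw [e1, e4]

/-- The overgroup. -/
abbrev overgroup : Subgroup (Equiv.Perm (ℤ × ℤ × Γ)) :=
  Subgroup.closure (Set.range (generatorPerm c))

theorem fibreMul_mem (hc : Subgroup.closure (Set.range c) = ⊤) (γ : Γ) :
    fibreMul γ ∈ overgroup c := by
  have hgen (k : Fin 4) : generatorPerm c k ∈ overgroup c :=
    Subgroup.subset_closure (Set.mem_range_self k)
  have h : Subgroup.closure (Set.range c) ≤ (overgroup c).comap fibreMul := by
    rw [Subgroup.closure_le]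
    rintro _ ⟨i, rfl⟩
    have hs : rowShift Γ ^ triangular i ∈ overgroup c := pow_mem (hgen 0) _
    have hx := mul_mem (mul_mem (mul_mem (inv_mem hs) (hgen 3)) hs) (hgen 2)
    -- Solving the identity for `fibreMul (c i)⁻¹` writes it as a commutator of elements of the
    -- overgroup.
    have := eq_mul_inv_of_mul_eq (eq_mul_inv_of_mul_eq (fibreMul_eq c i).symm)
    change fibreMul (c i) ∈ overgroup c
    rw [← inv_mem_iff, ← map_inv, this]
    exact mul_mem (mul_mem (mul_mem hx (hgen 1)) (inv_mem hx)) (inv_mem (hgen 1))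
  exact h (hc ▸ Subgroup.mem_top γ)

/-- The generators of the overgroup. -/
def generator (k : Fin 4) : overgroup c :=
  ⟨generatorPerm c k, Subgroup.subset_closure (Set.mem_range_self k)⟩

theorem closure_generator : Subgroup.closure (Set.range (generator c)) = ⊤ := by
  have h : Set.range (generator c) = ((↑) : overgroup c → _) ⁻¹' Set.range (generatorPerm c) := by
    ext x
    constructor
    · rintro ⟨k, rfl⟩
      exact ⟨k, rfl⟩
    · rintro ⟨k, hk⟩
      exact ⟨k, Subtype.ext hk⟩
  rw [h]
  exact Subgroup.closure_closure_coe_preimage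

end Permutations

/-! ### Following a point along a word. -/

theorem fin_four_cases (k : Fin 4) : k = 0 ∨ k = 1 ∨ k = 2 ∨ k = 3 := by
  revert k
  decide

theorem wordValue_cons {X G : Type*} [Group G] (g : X → G) (p : X × Bool) (w : List (X × Bool)) :
    wordValue g (p :: w) = (if p.2 then g p.1 else (g p.1)⁻¹) * wordValue g w := by
  simp [wordValue]

theorem map_wordValue {X G H : Type*} [Group G] [Group H] (φ : G →* H) (g : X → G)
    (w : List (X × Bool)) : φ (wordValue g w) = wordValue (fun x => φ (g x)) w := by
  induction w with
  | nil => simp [wordValue]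
  | cons p w ih =>
    rw [wordValue_cons, wordValue_cons, map_mul, ih]
    congr 1
    split_ifs <;> simp

/-- The data followed along a computation in the overgroup: the row `n`, the column `m`, the
displacement `j` of the row, the affine map by which the column has moved (multiplication by a sign,
which is `1` when `f` is true, followed by addition of `d`), and a word that describes the
fibre coordinate. -/
@[ext] structure Trace where
  n : ℤ
  m : ℤ
  j : ℤ
  d : ℤ
  f : Bool
  out : List (ℕ × Bool)

namespace Trace

def start (n m : ℤ) : Trace := ⟨n, m, 0, 0, true, []⟩

def flip (a : Trace) : Trace := { a with m := -a.m, d := -a.d, f := !a.f }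

/-- The displacement of the inverse of a letter. -/
def disp (b : Bool) : ℤ := if b then -1 else 1

/-- The word after the twist has been applied in a row of index `i`. -/
def emit (a : Trace) (i : ℕ) : List (ℕ × Bool) :=
  if a.m = 0 then a.out else (i, decide (0 < a.m)) :: a.out

/-- The effect of the inverse of a letter. -/
def step (a : Trace) (p : Fin 4 × Bool) : Trace :=
  match p.1 with
  | 0 => { a with n := a.n + disp p.2, j := a.j + disp p.2 }
  | 1 => if a.n = 0 then { a with m := a.m + disp p.2, d := a.d + disp p.2 } else a
  | 2 => if a.n = 0 then a.flip else a
  | 3 => match rowIndex a.n with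
    | some i => { a.flip with out := a.emit i }
    | none => a

def run (w : List (Fin 4 × Bool)) (a : Trace) : Trace := w.foldl step a

@[simp] theorem run_nil (a : Trace) : run [] a = a := rfl

@[simp] theorem run_cons (p : Fin 4 × Bool) (w : List (Fin 4 × Bool)) (a : Trace) :
    run (p :: w) a = run w (a.step p) := rfl

/-- The computation closes up, in the rows and in the columns. -/
def Closed (a : Trace) : Prop := a.j = 0 ∧ a.d = 0 ∧ a.f = true

variable {Γ : Type u} [Group Γ] (c : ℕ → Γ)

def point (a : Trace) (γ : Γ) : ℤ × ℤ × Γ := (a.n, a.m, wordValue c a.out * γ)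

theorem wordValue_emit (a : Trace) (i : ℕ) :
    wordValue c (a.emit i) = signFactor (c i) a.m * wordValue c a.out := by
  unfold emit signFactor
  rcases lt_trichotomy a.m 0 with h | h | h
  · rw [if_neg h.ne, wordValue_cons]; simp [h, not_lt.mpr h.le]
  · simp [h]
  · rw [if_neg h.ne', wordValue_cons]; simp [h]

theorem step_cases {motive : Trace → Prop} (a : Trace) (p : Fin 4 × Bool)
    (h0 : motive { a with n := a.n + disp p.2, j := a.j + disp p.2 })
    (h1 : a.n = 0 → motive { a with m := a.m + disp p.2, d := a.d + disp p.2 })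
    (h2 : a.n = 0 → motive a.flip)
    (h3 : ∀ i, rowIndex a.n = some i → motive { a.flip with out := a.emit i })
    (h : motive a) : motive (a.step p) := by
  obtain ⟨k, b⟩ := p
  obtain rfl | rfl | rfl | rfl := fin_four_cases k
  · exact h0
  · simp only [step]; split_ifs with hn
    · exact h1 hn
    · exact h
  · simp only [step]; split_ifs with hn
    · exact h2 hn
    · exact h
  · simp only [step]
    rcases hi : rowIndex a.n with _ | i
    · exact h
    · exact h3 i hi

theorem point_step (a : Trace) (p : Fin 4 × Bool) (γ : Γ) :
    (if p.2 then generatorPerm c p.1 else (generatorPerm c p.1)⁻¹)⁻¹ (a.point c γ) =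
      (a.step p).point c γ := by
  obtain ⟨k, b⟩ := p
  obtain rfl | rfl | rfl | rfl := fin_four_cases k
  · cases b
    · simp [generatorPerm, point, step, rowShift, disp]
    · simp [generatorPerm, point, step, rowShift, disp, Equiv.Perm.inv_def, sub_eq_add_neg]
  · by_cases h : a.n = 0
    · cases b
      · simp [generatorPerm, point, step, columnShift, disp, h]
      · simp [generatorPerm, point, step, columnShift, disp, h, Equiv.Perm.inv_def,
          sub_eq_add_neg]
    · cases b <;> simp [generatorPerm, point, step, columnShift, h, Equiv.Perm.inv_def]
  · by_cases h : a.n = 0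
    · cases b <;> simp [generatorPerm, point, step, reflection, flip, h, Equiv.Perm.inv_def]
    · cases b <;> simp [generatorPerm, point, step, reflection, h, Equiv.Perm.inv_def]
  · have e : (twist c)⁻¹ = twist c := (twistFun_involutive c).toPerm_symm
    have : (if b then generatorPerm c 3 else (generatorPerm c 3)⁻¹)⁻¹ = twist c := by
      cases b <;> simp [generatorPerm, e]
    change (if b then generatorPerm c 3 else (generatorPerm c 3)⁻¹)⁻¹ _ = _
    rw [this]
    rcases hi : rowIndex a.n with _ | i
    · simp [twist, twistFun, point, step, hi]
    · simp [twist, twistFun, point, step, hi, wordValue_emit, flip, mul_assoc]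

/-- Inversion reverses the order of the letters, so the leftmost letter acts first. A machine that
reads the input from left to right therefore follows the inverse of the word, which is just as good
for testing triviality. -/
theorem point_run (w : List (Fin 4 × Bool)) (a : Trace) (γ : Γ) :
    (wordValue (generatorPerm c) w)⁻¹ (a.point c γ) = (run w a).point c γ := by
  induction w generalizing a with
  | nil => simp [wordValue]
  | cons p w ih =>
    rw [wordValue_cons, mul_inv_rev, Equiv.Perm.mul_apply, point_step, ih, run_cons]

theorem n_run (w : List (Fin 4 × Bool)) (a : Trace) :
    (run w a).n - (run w a).j = a.n - a.j := by
  induction w generalizing a with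
  | nil => rfl
  | cons p w ih =>
    rw [run_cons, ih]
    apply step_cases (motive := fun b => b.n - b.j = a.n - a.j) a p <;> intros <;> simp [flip]

/-- Shifts translate the column, while the reflection and the twist both negate it. Which of them
act depends on the row alone, so the final column is an affine function of the initial one, with
coefficients recorded in `f` and `d`. -/
theorem m_run (w : List (Fin 4 × Bool)) (n m : ℤ) :
    (run w (start n m)).m =
      (if (run w (start n m)).f then m else -m) + (run w (start n m)).d := by
  suffices h : ∀ a : Trace, a.m = (if a.f then m else -m) + a.d →
      (run w a).m = (if (run w a).f then m else -m) + (run w a).d from h _ (by simp [start])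
  induction w with
  | nil => exact fun a h => h
  | cons p w ih =>
    intro a h
    refine ih _ ?_
    apply step_cases (motive := fun a => a.m = (if a.f then m else -m) + a.d) a p
    · exact h
    · intro _; simp only [h]; ring
    · intro _; simp only [flip, h]; cases a.f <;> simp [add_comm]
    · intro _ _; simp only [flip, h]; cases a.f <;> simp [add_comm]
    · exact h

/-- Everything except the column and the word is independent of the column. -/
theorem run_congr_column (w : List (Fin 4 × Bool)) (a b : Trace)
    (h : a.n = b.n ∧ a.j = b.j ∧ a.d = b.d ∧ a.f = b.f) :
    (run w a).n = (run w b).n ∧ (run w a).j = (run w b).j ∧ (run w a).d = (run w b).d ∧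
      (run w a).f = (run w b).f := by
  induction w generalizing a b with
  | nil => exact h
  | cons p w ih =>
    refine ih _ _ ?_
    obtain ⟨hn, hj, hd, hf⟩ := h
    obtain ⟨k, e⟩ := p
    obtain rfl | rfl | rfl | rfl := fin_four_cases k
    · simp [step, hn, hj, hd, hf]
    · by_cases h0 : b.n = 0 <;> simp [step, hn, hj, hd, hf, h0]
    · by_cases h0 : b.n = 0 <;> simp [step, hn, hj, hd, hf, h0, flip]
    · rcases hi : rowIndex b.n with _ | i <;> simp [step, hn, hj, hd, hf, hi, flip]

/-- An affine map `x ↦ ± x + d` is the identity as soon as it fixes `0` and `1`. This turns a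
condition on all columns into one that can be read off from a single trace; column `0` alone
returning would not exclude a reflection. -/
theorem closed_iff (w : List (Fin 4 × Bool)) (n : ℤ) :
    (∀ m, (run w (start n m)).n = n ∧ (run w (start n m)).m = m) ↔
      (run w (start n 0)).Closed := by
  have hcol (m : ℤ) := run_congr_column w (start n m) (start n 0) (by simp [start])
  have hrow := n_run w (start n 0)
  simp only [start, sub_zero] at hrow
  constructor
  · intro h
    have h0 := m_run w n 0
    have h1 := m_run w n 1
    rw [(h 0).2] at h0
    rw [(h 1).2, (hcol 1).2.2.1, (hcol 1).2.2.2] at h1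
    have hd : (run w (start n 0)).d = 0 := by
      cases hf : (run w (start n 0)).f <;> simp [hf] at h0 <;> omega
    refine ⟨?_, hd, ?_⟩
    · have := (h 0).1
      simp only [start] at this ⊢
      omega
    · cases hf : (run w (start n 0)).f
      · simp [hf, hd] at h1
      · rfl
  · rintro ⟨hj, hd, hf⟩ m
    have hm := m_run w n m
    obtain ⟨k1, k2, k3, k4⟩ := hcol m
    rw [k3, k4, hd, hf] at hm
    refine ⟨?_, by simpa using hm⟩
    rw [k1]
    simp only [start] at hj ⊢
    omega

theorem closed_congr (w : List (Fin 4 × Bool)) (n m : ℤ) :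
    (run w (start n m)).Closed ↔ (run w (start n 0)).Closed := by
  obtain ⟨k1, k2, k3, k4⟩ := run_congr_column w (start n m) (start n 0) (by simp [start])
  unfold Closed
  rw [k2, k3, k4]

/-- The word is trivial if and only if all computations close up with a trivial word. -/
theorem wordValue_eq_one_iff (w : List (Fin 4 × Bool)) :
    wordValue (generatorPerm c) w = 1 ↔
      ∀ n m, (run w (start n m)).Closed ∧ wordValue c (run w (start n m)).out = 1 := by
  have hp (n m : ℤ) (γ : Γ) : (start n m).point c γ = (n, m, γ) := by
    simp [start, point, wordValue]
  constructor
  · intro h n m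
    have key (m : ℤ) : (run w (start n m)).point c 1 = (n, m, 1) := by
      rw [← point_run, h, hp]; rfl
    rw [closed_congr, ← closed_iff]
    refine ⟨fun m => ?_, ?_⟩
    · have := key m
      simp only [point, Prod.mk.injEq] at this
      exact ⟨this.1, this.2.1⟩
    · have := key m
      simp only [point, Prod.mk.injEq, mul_one] at this
      exact this.2.2
  · intro h
    rw [← inv_eq_one]
    ext1 x
    obtain ⟨n, m, γ⟩ := x
    have hcl := (closed_iff w n).mpr (h n 0).1 m
    rw [← hp, point_run, Equiv.Perm.one_apply, hp, point, hcl.1, hcl.2, (h n m).2, one_mul]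

/-! ### Reduction to finitely many starting points. -/

/-- Far from column `0` the word depends only on the sign of the column. -/
theorem out_congr_far (w : List (Fin 4 × Bool)) (a b : Trace) (hn : a.n = b.n)
    (ho : a.out = b.out)
    (hm : (w.length < a.m ∧ w.length < b.m) ∨ (a.m < -w.length ∧ b.m < -w.length)) :
    (run w a).out = (run w b).out := by
  induction w generalizing a b with
  | nil => exact ho
  | cons p w ih =>
    simp only [List.length_cons, Nat.cast_add, Nat.cast_one] at hm
    rw [run_cons, run_cons]
    obtain ⟨k, e⟩ := p
    -- A letter moves the column by at most one while the required margin, the remaining length,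
    -- drops by one. Hence neither column reaches `0`; a flip only exchanges the two alternatives of
    -- `hm`.
    have hd : disp e = 1 ∨ disp e = -1 := by unfold disp; split_ifs <;> simp
    obtain rfl | rfl | rfl | rfl := fin_four_cases k
    · refine ih _ _ (by simp [step, hn]) (by simp [step, ho]) ?_
      simp only [step]
      omega
    · by_cases h0 : b.n = 0
      · refine ih _ _ (by simp [step, hn, h0]) (by simp [step, ho, hn, h0]) ?_
        simp only [step, hn, h0, if_true]
        omega
      · refine ih _ _ (by simp [step, hn, h0]) (by simp [step, ho, hn, h0]) ?_
        simp only [step, hn, h0, if_false]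
        omega
    · by_cases h0 : b.n = 0
      · refine ih _ _ (by simp [step, hn, h0, flip]) (by simp [step, ho, hn, h0, flip]) ?_
        simp only [step, hn, h0, if_true, flip]
        omega
      · refine ih _ _ (by simp [step, hn, h0]) (by simp [step, ho, hn, h0]) ?_
        simp only [step, hn, h0, if_false]
        omega
    · rcases hi : rowIndex b.n with _ | i
      · refine ih _ _ (by simp [step, hn, hi]) (by simp [step, ho, hn, hi]) ?_
        simp only [step, hn, hi]
        omega
      · refine ih _ _ (by simp [step, hn, hi, flip]) ?_ ?_
        · simp only [step, hn, hi, emit, ho]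
          have e1 : a.m ≠ 0 := by omega
          have e2 : b.m ≠ 0 := by omega
          have e3 : 0 < a.m ↔ 0 < b.m := by omega
          simp [e1, e2, e3]
        · simp only [step, hn, hi, flip]
          omega

/-- The row shift acts in every row, so the displacement only counts its letters. One start decides
for all of them whether the row returns. -/
theorem j_run_congr (w : List (Fin 4 × Bool)) (a b : Trace) (h : a.j = b.j) :
    (run w a).j = (run w b).j := by
  induction w generalizing a b with
  | nil => exact h
  | cons p w ih =>
    refine ih _ _ ?_
    have key (a : Trace) : (a.step p).j = if p.1 = 0 then a.j + disp p.2 else a.j := by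
      obtain ⟨k, e⟩ := p
      obtain rfl | rfl | rfl | rfl := fin_four_cases k
      · simp [step]
      · simp only [step]; split_ifs <;> simp_all
      · simp only [step]; split_ifs <;> simp_all [flip]
      · rcases hi : rowIndex a.n with _ | i <;> simp [step, hi, flip]
    rw [key, key, h]

/-- Far from row `0`, and when only rows of one index are met, the word is determined by the
parity of the number of twists. -/
theorem run_far (w : List (Fin 4 × Bool)) (i : ℕ) (m : ℤ) (a : Trace)
    (h0 : ∀ x : ℤ, |x| ≤ w.length → a.n + x ≠ 0)
    (hi : ∀ x : ℤ, |x| ≤ w.length → ∀ i', rowIndex (a.n + x) = some i' → i' = i)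
    (hd : a.d = 0)
    (hm : a.m = if a.f then m else -m)
    (ho : wordValue c a.out = if a.f then 1 else signFactor (c i) m) :
    (run w a).d = 0 ∧
      wordValue c (run w a).out = if (run w a).f then 1 else signFactor (c i) m := by
  induction w generalizing a with
  | nil => exact ⟨hd, ho⟩
  | cons p w ih =>
    have hn0 : a.n ≠ 0 := by simpa using h0 0 (by simp; omega)
    have hlen : ((p :: w).length : ℤ) = w.length + 1 := by simp
    rw [run_cons]
    have hsame : ∀ x : ℤ, |x| ≤ w.length → |x| ≤ (p :: w).length := fun x hx => by omega
    obtain ⟨k, e⟩ := p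
    have hdp : |disp e| = 1 := by unfold disp; split_ifs <;> simp
    obtain rfl | rfl | rfl | rfl := fin_four_cases k
    · refine ih _ (fun x hx => ?_) (fun x hx i' => ?_) hd hm ho
      · simp only [step, add_assoc]
        exact h0 _ ((abs_add_le _ _).trans (by rw [hlen]; omega))
      · simp only [step, add_assoc]
        exact hi _ ((abs_add_le _ _).trans (by rw [hlen]; omega)) _
    · have : a.step (1, e) = a := by simp [step, hn0]
      rw [this]; exact (ih a (fun x hx => h0 x (hsame x hx)) (fun x hx => hi x (hsame x hx)) hd hm ho)
    · have : a.step (2, e) = a := by simp [step, hn0]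
      rw [this]; exact (ih a (fun x hx => h0 x (hsame x hx)) (fun x hx => hi x (hsame x hx)) hd hm ho)
    · rcases hr : rowIndex a.n with _ | i'
      · have : a.step (3, e) = a := by simp [step, hr]
        rw [this]; exact (ih a (fun x hx => h0 x (hsame x hx)) (fun x hx => hi x (hsame x hx))
          hd hm ho)
      · have hii : i' = i := hi 0 (by simp; omega) i' (by simpa using hr)
        subst hii
        have : a.step (3, e) = { a.flip with out := a.emit i' } := by simp [step, hr]
        have hgoal := ih { a.flip with out := a.emit i' } (fun x hx => h0 x (hsame x hx))
          (fun x hx => hi x (hsame x hx)) (by simp [flip, hd])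
          (by simp only [flip, hm]; cases a.f <;> simp)
          (by
            simp only [flip, wordValue_emit, ho, hm]
            -- Away from row `0` only twists change the column, so consecutive twists happen at
            -- opposite columns and their factors cancel in pairs.
            cases a.f <;> simp [signFactor_neg_mul])
        rw [this]; exact hgoal

/-- Far from row `0` the parity of the number of twists depends only on the pattern of the rows
that have an index. -/
theorem f_congr_far (w : List (Fin 4 × Bool)) (a b : Trace)
    (ha : ∀ x : ℤ, |x| ≤ w.length → a.n + x ≠ 0)
    (hb : ∀ x : ℤ, |x| ≤ w.length → b.n + x ≠ 0)
    (hi : ∀ x : ℤ, |x| ≤ w.length → ((rowIndex (a.n + x)).isSome ↔ (rowIndex (b.n + x)).isSome))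
    (hf : a.f = b.f) : (run w a).f = (run w b).f := by
  induction w generalizing a b with
  | nil => exact hf
  | cons p w ih =>
    have ha0 : a.n ≠ 0 := by simpa using ha 0 (by simp; omega)
    have hb0 : b.n ≠ 0 := by simpa using hb 0 (by simp; omega)
    have hi0 : (rowIndex a.n).isSome ↔ (rowIndex b.n).isSome := by
      simpa using hi 0 (by simp; omega)
    have hlen : ((p :: w).length : ℤ) = w.length + 1 := by simp
    rw [run_cons, run_cons]
    have hsame : ∀ x : ℤ, |x| ≤ w.length → |x| ≤ (p :: w).length := fun x hx => by omega
    obtain ⟨k, e⟩ := p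
    have hdp : |disp e| = 1 := by unfold disp; split_ifs <;> simp
    obtain rfl | rfl | rfl | rfl := fin_four_cases k
    · have hx : ∀ x : ℤ, |x| ≤ w.length → |disp e + x| ≤ ((((0, e) : Fin 4 × Bool) :: w).length) :=
        fun x hx => (abs_add_le _ _).trans (by rw [hlen]; omega)
      refine ih _ _ (fun x h => ?_) (fun x h => ?_) (fun x h => ?_) hf
      · simp only [step, add_assoc]; exact ha _ (hx x h)
      · simp only [step, add_assoc]; exact hb _ (hx x h)
      · simp only [step, add_assoc]; exact hi _ (hx x h)
    · have e1 : a.step (1, e) = a := by simp [step, ha0]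
      have e2 : b.step (1, e) = b := by simp [step, hb0]
      rw [e1, e2]; exact (ih a b (fun x h => ha x (hsame x h)) (fun x h => hb x (hsame x h))
        (fun x h => hi x (hsame x h)) hf)
    · have e1 : a.step (2, e) = a := by simp [step, ha0]
      have e2 : b.step (2, e) = b := by simp [step, hb0]
      rw [e1, e2]; exact (ih a b (fun x h => ha x (hsame x h)) (fun x h => hb x (hsame x h))
        (fun x h => hi x (hsame x h)) hf)
    · have key (a : Trace) : (a.step (3, e)).n = a.n ∧
          (a.step (3, e)).f = if (rowIndex a.n).isSome then !a.f else a.f := by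
        rcases hr : rowIndex a.n with _ | i' <;> simp [step, hr, flip]
      refine ih _ _ (fun x h => ?_) (fun x h => ?_) (fun x h => ?_) ?_
      · exact (key a).1.symm ▸ ha x (hsame x h)
      · exact (key b).1.symm ▸ hb x (hsame x h)
      · exact (key a).1.symm ▸ (key b).1.symm ▸ hi x (hsame x h)
      · refine (key a).2.trans (Eq.trans ?_ (key b).2.symm)
        simp [hi0, hf]

/-- Finitely many computations decide whether a word is trivial. -/
theorem wordValue_eq_one_iff_bounded (w : List (Fin 4 × Bool)) :
    wordValue (generatorPerm c) w = 1 ↔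
      ∀ n m : ℤ, n.natAbs < triangular (2 * w.length + 4) → m.natAbs ≤ w.length + 1 →
        (run w (start n m)).Closed ∧ wordValue c (run w (start n m)).out = 1 := by
  rw [wordValue_eq_one_iff]
  refine ⟨fun h n m _ _ => h n m, fun h n m => ?_⟩
  set L := w.length with hL
  have mono {i k : ℕ} (hik : i ≤ k) : triangular i ≤ triangular k := by
    rcases hik.lt_or_eq with h | rfl
    · have := triangular_add_le h; omega
    · exact le_rfl
  have hT : triangular (2 * L + 4) = triangular (2 * L + 3) + (2 * L + 4) := rfl
  have hT0 := le_triangular (2 * L + 3)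
  by_cases hn : n.natAbs < triangular (2 * L + 4)
  · refine ⟨(closed_congr w n m).mpr (h n 0 hn (by simp)).1, ?_⟩
    by_cases hm : m.natAbs ≤ L + 1
    · exact (h n m hn hm).2
    · rcases lt_or_ge m 0 with hm0 | hm0
      · rw [out_congr_far w (start n m) (start n (-(L + 1))) rfl rfl
          (Or.inr ⟨by simp only [start]; omega, by simp only [start]; omega⟩)]
        exact (h n _ hn (by omega)).2
      · rw [out_congr_far w (start n m) (start n (L + 1)) rfl rfl
          (Or.inl ⟨by simp only [start]; omega, by simp only [start]; omega⟩)]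
        exact (h n _ hn (by omega)).2
  -- From `triangular (2 * L + 3)` to `triangular (2 * L + 4)` there are `2 * L + 4` rows, so `L`
  -- steps from outside the tested range do not lead back to an index of at most `2 * L + 3`.
  have nearby (x : ℤ) (hx : |x| ≤ (L : ℤ)) (i : ℕ) (hi : rowIndex (n + x) = some i) :
      2 * L + 4 ≤ i := by
    rw [rowIndex_eq_some_iff] at hi
    rw [abs_le] at hx
    by_contra! hlt
    have := mono (show i ≤ 2 * L + 3 by omega)
    omega
  -- Indices in reach are so large that their rows are more than `2 * L` apart, and row `0`
  -- separating the two signs is out of reach. So two different indices cannot both be met.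
  have iso (x y : ℤ) (hx : |x| ≤ (L : ℤ)) (hy : |y| ≤ (L : ℤ)) (i k : ℕ)
      (hi : rowIndex (n + x) = some i) (hk : rowIndex (n + y) = some k) : i ≤ k := by
    have h1 := nearby x hx i hi
    rw [rowIndex_eq_some_iff] at hi hk
    rw [abs_le] at hx hy
    by_contra! hlt
    have := triangular_add_le hlt
    omega
  have hne (x : ℤ) (hx : |x| ≤ (L : ℤ)) : n + x ≠ 0 := by
    rw [abs_le] at hx
    omega
  have hone : ∃ i, ∀ x : ℤ, |x| ≤ (L : ℤ) → ∀ i', rowIndex (n + x) = some i' → i' = i := by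
    by_cases hex : ∃ x : ℤ, |x| ≤ (L : ℤ) ∧ ∃ i, rowIndex (n + x) = some i
    · obtain ⟨x, hx, i, hi⟩ := hex
      exact ⟨i, fun y hy k hk => le_antisymm (iso y x hy hx k i hk hi) (iso x y hx hy i k hi hk)⟩
    · push Not at hex
      exact ⟨0, fun x hx i' hi' => absurd hi' (hex x hx i')⟩
  have hf : (run w (start n m)).f = true := by
    by_cases hex : ∃ x : ℤ, |x| ≤ (L : ℤ) ∧ ∃ i, rowIndex (n + x) = some i
    · obtain ⟨x, hx, i, hi⟩ := hex
      have hx' := abs_le.mp hx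
      -- This start lies in the tested range and sees the row `triangular (2 * L + 3)` at the same
      -- offset `x`, with no other twisted row within distance `L`.
      have hr := h (triangular (2 * L + 3) - x) 0 (by omega) (by simp)
      rw [← hr.1.2.2]
      refine f_congr_far w _ _ hne (fun y hy => ?_) (fun y hy => ?_) rfl
      · have := abs_le.mp hy
        simp only [start]
        omega
      · have hy' := abs_le.mp hy
        simp only [start, Option.isSome_iff_exists]
        constructor
        · rintro ⟨k, hk⟩
          have hik := le_antisymm (iso x y hx hy i k hi hk) (iso y x hy hx k i hk hi)
          subst hik
          rw [rowIndex_eq_some_iff] at hi hk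
          refine ⟨2 * L + 3, ?_⟩
          rw [rowIndex_eq_some_iff]
          omega
        · rintro ⟨k, hk⟩
          rw [rowIndex_eq_some_iff] at hk
          have : k = 2 * L + 3 := by
            rcases lt_trichotomy k (2 * L + 3) with h1 | h1 | h1
            · have := triangular_add_le h1; omega
            · exact h1
            · have := triangular_add_le h1; omega
          subst this
          exact ⟨i, by rwa [show y = x by omega]⟩
    · have hr := h (triangular (2 * L + 3) + (L + 1)) 0 (by omega) (by simp)
      rw [← hr.1.2.2]
      refine f_congr_far w _ _ hne (fun y hy => ?_) (fun y hy => ?_) rfl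
      · have := abs_le.mp hy
        simp only [start]
        omega
      · have hy' := abs_le.mp hy
        simp only [start, Option.isSome_iff_exists]
        refine ⟨fun ⟨k, hk⟩ => absurd ⟨y, hy, k, hk⟩ hex, fun ⟨k, hk⟩ => ?_⟩
        rw [rowIndex_eq_some_iff] at hk
        exfalso
        rcases Nat.lt_or_ge k (2 * L + 4) with h1 | h1
        · have := mono (show k ≤ 2 * L + 3 by omega); omega
        · have := mono h1; omega
  obtain ⟨i, hi⟩ := hone
  obtain ⟨hd, ho⟩ := run_far c w i m (start n m) hne hi rfl rfl (by simp [start, wordValue])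
  refine ⟨⟨?_, hd, hf⟩, by simpa [hf] using ho⟩
  rw [j_run_congr w (start n m) (start 0 0) rfl]
  exact (h 0 0 (by simp; omega) (by simp)).1.1

end Trace

/-! ### Faithfulness of the code `nu`. -/

section Encoding

theorem replicate_append_cancel {α : Type*} {x y : α} (hxy : y ≠ x) (i k : ℕ) (r s : List α)
    {y' : α} (hxy' : y' ≠ x)
    (h : List.replicate i x ++ y :: r = List.replicate k x ++ y' :: s) :
    i = k ∧ y = y' ∧ r = s := by
  induction i generalizing k with
  | zero =>
    cases k with
    | zero => simpa using h
    | succ k => simp [List.replicate_succ, hxy] at h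
  | succ i ih =>
    cases k with
    | zero => simp [List.replicate_succ, Ne.symm hxy'] at h
    | succ k =>
      have := ih k (by simpa [List.replicate_succ] using h)
      simpa using this

/-- The letters `b` before the first `a^ε` count the index of the first letter; after that count and
`ε` are read, the matching block of `b⁻¹` cancels and the rest is decoded in the same way. Because
of injectivity, accepting the code of `u` says something about `u` itself and not about another word
with the same code. -/
theorem nu_injective : Function.Injective nu := by
  intro u v
  induction u generalizing v with
  | nil =>
    intro h
    cases v with
    | nil => rfl
    | cons q v => simp [nu, nuLetter] at h
  | cons p u ih =>
    intro h
    cases v with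
    | nil => simp [nu, nuLetter] at h
    | cons q v =>
      simp only [nu, List.flatMap_cons, nuLetter, List.append_assoc, List.singleton_append] at h
      obtain ⟨h1, h2, h3⟩ := replicate_append_cancel (by simp) _ _ _ _ (by simp) h
      rw [h1] at h3
      have := ih (List.append_cancel_left h3)
      rw [this, List.cons.injEq]
      exact ⟨Prod.ext h1 (by simpa using h2), rfl⟩

theorem nu_mem_encodedWordProblem_iff {Γ : Type u} [Group Γ] (c : ℕ → Γ) (u : List (ℕ × Bool)) :
    nu u ∈ encodedWordProblem c ↔ wordValue c u = 1 := by
  constructor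
  · rintro ⟨v, hv, h⟩
    rwa [nu_injective h]
  · intro h
    exact ⟨u, h, rfl⟩

theorem mem_wordProblem_generator_iff {Γ : Type u} [Group Γ] (c : ℕ → Γ)
    (w : List (Fin 4 × Bool)) :
    w ∈ wordProblem (generator c) ↔ wordValue (generatorPerm c) w = 1 := by
  have h := map_wordValue (overgroup c).subtype (generator c) w
  change wordValue (generator c) w = 1 ↔ _
  rw [← map_eq_one_iff _ (overgroup c).subtype_injective, h]
  rfl

end Encoding

/-! ### Termination and halting of nondeterministic code. -/

open Turing TM2

section Leads

variable {K : Type} [DecidableEq K] {Γ : K → Type} {σ Λ Λ' : Type}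

/-- The internal state together with the contents of the stacks. -/
abbrev Memory (Γ : K → Type) (σ : Type) : Type := σ × (∀ k, List (Γ k))

/-- The effect of a statement on a memory. -/
def exec (q : Stmt Γ Λ σ) (x : Memory Γ σ) : Cfg Γ Λ σ := stepAux q x.1 x.2

/-- A configuration made of a label and a memory. -/
def Cfg.of (l : Option Λ) (x : Memory Γ σ) : Cfg Γ Λ σ := ⟨l, x.1, x.2⟩

/-- Every computation from the configuration takes at most the given number of steps. -/
inductive Terminates (code : Λ → List (Stmt Γ Λ σ)) : ℕ → Cfg Γ Λ σ → Prop
  | halt (T : ℕ) (x : Memory Γ σ) : Terminates code T (Cfg.of none x)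
  | step (T : ℕ) (l : Λ) (x : Memory Γ σ) (h : ∀ q ∈ code l, Terminates code T (exec q x)) :
      Terminates code (T + 1) (Cfg.of (some l) x)

/-- Some computation from the configuration halts with the given memory. -/
inductive Halts (code : Λ → List (Stmt Γ Λ σ)) : Cfg Γ Λ σ → Memory Γ σ → Prop
  | halt (x : Memory Γ σ) : Halts code (Cfg.of none x) x
  | step (l : Λ) (x y : Memory Γ σ) (q : Stmt Γ Λ σ) (hq : q ∈ code l)
      (h : Halts code (exec q x) y) : Halts code (Cfg.of (some l) x) y

theorem Terminates.mono {code : Λ → List (Stmt Γ Λ σ)} {T T' : ℕ} {c : Cfg Γ Λ σ}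
    (h : Terminates code T c) (hT : T ≤ T') : Terminates code T' c := by
  induction h generalizing T' with
  | halt T x => exact .halt T' x
  | step T l x h ih =>
    obtain ⟨T', rfl⟩ : ∃ T'', T' = T'' + 1 := ⟨T' - 1, by omega⟩
    exact .step T' l x fun q hq => ih q hq (by omega)

theorem halts_none_iff {code : Λ → List (Stmt Γ Λ σ)} {x y : Memory Γ σ} :
    Halts code (Cfg.of none x) y ↔ y = x := by
  constructor
  · generalize hc : Cfg.of none x = c
    intro h
    cases h with
    | halt _ =>
      simp only [Cfg.of, Cfg.mk.injEq, true_and] at hc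
      exact (Prod.ext hc.1 hc.2).symm
    | step l x' _ q hq h => simp [Cfg.of] at hc
  · rintro rfl
    exact .halt _

theorem halts_some_iff {code : Λ → List (Stmt Γ Λ σ)} {l : Λ} {x y : Memory Γ σ} :
    Halts code (Cfg.of (some l) x) y ↔ ∃ q ∈ code l, Halts code (exec q x) y := by
  constructor
  · generalize hc : Cfg.of (some l) x = c
    intro h
    cases h with
    | halt _ => simp [Cfg.of] at hc
    | step l' x' _ q hq h =>
      simp only [Cfg.of, Cfg.mk.injEq, Option.some.injEq] at hc
      obtain ⟨rfl, h1, h2⟩ := hc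
      obtain rfl : x = x' := Prod.ext h1 h2
      exact ⟨q, hq, h⟩
  · rintro ⟨q, hq, h⟩
    exact .step l x y q hq h

namespace Turing.TM2.Stmt

/-- Rename the labels and replace `halt` by a given statement. -/
def relabel (g : Λ → Λ') (e : Stmt Γ Λ' σ) : Stmt Γ Λ σ → Stmt Γ Λ' σ
  | push k u q => push k u (relabel g e q)
  | peek k u q => peek k u (relabel g e q)
  | pop k u q => pop k u (relabel g e q)
  | load u q => load u (relabel g e q)
  | branch u q r => branch u (relabel g e q) (relabel g e r)
  | goto u => goto fun v => g (u v)
  | halt => e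

/-- Replace jumps to `true` and to `false` by given statements. -/
def select (e e' : Stmt Γ Λ σ) : Stmt Γ Bool σ → Stmt Γ Λ σ
  | push k u q => push k u (select e e' q)
  | peek k u q => peek k u (select e e' q)
  | pop k u q => pop k u (select e e' q)
  | load u q => load u (select e e' q)
  | branch u q r => branch u (select e e' q) (select e e' r)
  | goto u => branch u e e'
  | halt => halt

end Turing.TM2.Stmt

/-- The statement that passes control to the given label, or halts. -/
def exitTo : Option Λ → Stmt Γ Λ σ
  | some l => .goto fun _ => l
  | none => .halt

theorem exec_exitTo (l : Option Λ) (x : Memory Γ σ) : exec (exitTo l) x = Cfg.of l x := by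
  cases l <;> rfl

theorem exec_relabel (g : Λ → Λ') (e : Option Λ') (q : Stmt Γ Λ σ) (x : Memory Γ σ) :
    exec (Stmt.relabel g (exitTo e) q) x =
      Cfg.of ((exec q x).l.elim e fun l => some (g l)) ((exec q x).var, (exec q x).stk) := by
  obtain ⟨v, S⟩ := x
  unfold exec
  induction q generalizing v S with
  | push k u q ih => simp only [Stmt.relabel, stepAux]; exact ih _ _
  | peek k u q ih => simp only [Stmt.relabel, stepAux]; exact ih _ _
  | pop k u q ih => simp only [Stmt.relabel, stepAux]; exact ih _ _
  | load u q ih => simp only [Stmt.relabel, stepAux]; exact ih _ _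
  | branch u q r ih ih' =>
    simp only [Stmt.relabel, stepAux]
    cases u v
    · exact ih' _ _
    · exact ih _ _
  | goto u => rfl
  | halt => exact exec_exitTo e (v, S)

theorem exec_select (e e' : Stmt Γ Λ σ) (q : Stmt Γ Bool σ) (x y : Memory Γ σ) (b : Bool)
    (h : exec q x = Cfg.of (some b) y) : exec (Stmt.select e e' q) x = exec (cond b e e') y := by
  obtain ⟨v, S⟩ := x
  unfold exec at h ⊢
  induction q generalizing v S with
  | push k u q ih => simp only [Stmt.select, stepAux] at h ⊢; exact ih _ _ h
  | peek k u q ih => simp only [Stmt.select, stepAux] at h ⊢; exact ih _ _ h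
  | pop k u q ih => simp only [Stmt.select, stepAux] at h ⊢; exact ih _ _ h
  | load u q ih => simp only [Stmt.select, stepAux] at h ⊢; exact ih _ _ h
  | branch u q r ih ih' =>
    simp only [Stmt.select, stepAux] at h ⊢
    cases hu : u v
    · rw [hu] at h; exact ih' _ _ h
    · rw [hu] at h; exact ih _ _ h
  | goto u =>
    simp only [stepAux, Cfg.of, Cfg.mk.injEq, Option.some.injEq] at h
    obtain ⟨rfl, rfl, rfl⟩ := h
    simp only [Stmt.select, stepAux]
    cases u y.1 <;> rfl
  | halt => simp [stepAux, Cfg.of] at h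

/-- Sequential composition of computations. -/
theorem Terminates.bind {code : Λ → List (Stmt Γ Λ σ)} {code' : Λ' → List (Stmt Γ Λ' σ)}
    (g : Λ → Λ') (e : Option Λ')
    (hcode : ∀ l, code' (g l) = (code l).map (Stmt.relabel g (exitTo e)))
    {T T' : ℕ} {c : Cfg Γ Λ σ} (h : Terminates code T c)
    (hR : ∀ x, Halts code c x → Terminates code' T' (Cfg.of e x)) :
    Terminates code' (T + T') (Cfg.of (c.l.elim e fun l => some (g l)) (c.var, c.stk)) ∧
      ∀ y, Halts code' (Cfg.of (c.l.elim e fun l => some (g l)) (c.var, c.stk)) y ↔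
        ∃ x, Halts code c x ∧ Halts code' (Cfg.of e x) y := by
  induction h with
  | halt T x =>
    refine ⟨(hR x (.halt x)).mono (by omega), fun y => ⟨fun h => ⟨x, .halt x, h⟩, ?_⟩⟩
    rintro ⟨x', hx', hy⟩
    rw [halts_none_iff] at hx'
    exact hx' ▸ hy
  | step T l x h ih =>
    have ih' (q) (hq : q ∈ code l) :=
      ih q hq fun y hy => hR y (halts_some_iff.mpr ⟨q, hq, hy⟩)
    simp only [← exec_relabel] at ih'
    constructor
    · refine (Terminates.step (T + T') (g l) x ?_).mono (by omega)
      intro q' hq'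
      rw [hcode, List.mem_map] at hq'
      obtain ⟨q, hq, rfl⟩ := hq'
      exact (ih' q hq).1
    · intro y
      change Halts code' (Cfg.of (some (g l)) x) y ↔ _
      rw [halts_some_iff, hcode]
      constructor
      · rintro ⟨q', hq', hy⟩
        rw [List.mem_map] at hq'
        obtain ⟨q, hq, rfl⟩ := hq'
        obtain ⟨z, hz, hzy⟩ := ((ih' q hq).2 y).mp hy
        exact ⟨z, halts_some_iff.mpr ⟨q, hq, hz⟩, hzy⟩
      · rintro ⟨z, hz, hzy⟩
        obtain ⟨q, hq, hz⟩ := halts_some_iff.mp hz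
        exact ⟨_, List.mem_map_of_mem hq, ((ih' q hq).2 y).mpr ⟨z, hz, hzy⟩⟩

end Leads

/-! ### Structured programs and their rules. -/

/-- A program, possibly nondeterministic, on given stacks and internal states.  A label without
statements aborts the computation. -/
structure Program {K : Type} (Γ : K → Type) (σ : Type) where
  Λ : Type
  [finiteΛ : Finite Λ]
  main : Λ
  code : Λ → List (Stmt Γ Λ σ)

namespace Program

variable {K : Type} [DecidableEq K] {Γ : K → Type} {σ : Type}

instance (P : Program Γ σ) : Finite P.Λ := P.finiteΛ

/-- Every computation of the program that starts with memory `x` takes at most `T` steps, and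
the possible final memories are exactly those in `S`. -/
def Runs (P : Program Γ σ) (x : Memory Γ σ) (T : ℕ) (S : Memory Γ σ → Prop) : Prop :=
  Terminates P.code T (Cfg.of (some P.main) x) ∧
    ∀ y, Halts P.code (Cfg.of (some P.main) x) y ↔ S y

/-- The computations of the program that start with memory `x` take at most `T` steps; if `φ`
holds, some of them halt and all that do so have final memory `y`, and otherwise none halts. -/
def Spec (P : Program Γ σ) (x : Memory Γ σ) (T : ℕ) (φ : Prop) (y : Memory Γ σ) : Prop :=
  P.Runs x T fun z => z = y ∧ φ

def Deterministic (P : Program Γ σ) : Prop := ∀ l, (P.code l).length ≤ 1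

theorem Runs.mono {P : Program Γ σ} {x : Memory Γ σ} {T T' : ℕ} {S : Memory Γ σ → Prop}
    (h : P.Runs x T S) (hT : T ≤ T') : P.Runs x T' S := ⟨h.1.mono hT, h.2⟩

theorem Spec.mono {P : Program Γ σ} {x y : Memory Γ σ} {T T' : ℕ} {φ : Prop}
    (h : P.Spec x T φ y) (hT : T ≤ T') : P.Spec x T' φ y := Runs.mono h hT

theorem Spec.congr {P : Program Γ σ} {x y : Memory Γ σ} {T : ℕ} {φ ψ : Prop}
    (h : P.Spec x T φ y) (hφ : φ ↔ ψ) : P.Spec x T ψ y := by rwa [← propext hφ]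

/-- Run one program after another. -/
def seq (P Q : Program Γ σ) : Program Γ σ where
  Λ := P.Λ ⊕ Q.Λ
  main := .inl P.main
  code := Sum.elim
    (fun l => (P.code l).map (Stmt.relabel Sum.inl (exitTo (some (Sum.inr Q.main)))))
    (fun l => (Q.code l).map (Stmt.relabel Sum.inr (exitTo none)))

omit [DecidableEq K] in
theorem Deterministic.seq {P Q : Program Γ σ} (hP : P.Deterministic) (hQ : Q.Deterministic) :
    (P.seq Q).Deterministic := by
  rintro (l | l)
  · simpa [Program.seq] using hP l
  · simpa [Program.seq] using hQ l

/-- The first program may end in many memories, as a nondeterministic machine does. If the second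
one leads all of them to the same `y`, the composite has a unique outcome again, and its condition
asks for one good intermediate memory. -/
theorem Runs.seq {P Q : Program Γ σ} {x y : Memory Γ σ} {T T' : ℕ} {S ψ : Memory Γ σ → Prop}
    (hP : P.Runs x T S) (hQ : ∀ z, S z → Q.Spec z T' (ψ z) y) :
    (P.seq Q).Spec x (T + T') (∃ z, S z ∧ ψ z) y := by
  have hQ' (z) (hz : Halts P.code (Cfg.of (some P.main) x) z) :=
    (hQ z ((hP.2 z).mp hz)).1.bind (code' := (P.seq Q).code) Sum.inr none (fun _ => rfl)
      (T' := 0) (fun y _ => .halt 0 y)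
  have key := hP.1.bind (code' := (P.seq Q).code) Sum.inl (some (Sum.inr Q.main)) (fun _ => rfl)
    (T' := T') (fun z hz => (hQ' z hz).1)
  refine ⟨key.1, fun u => (key.2 u).trans ?_⟩
  constructor
  · rintro ⟨z, hz, hzu⟩
    obtain ⟨u', hu', hu⟩ := ((hQ' z hz).2 u).mp hzu
    rw [halts_none_iff] at hu
    subst hu
    have hSz := (hP.2 z).mp hz
    obtain ⟨rfl, hψ⟩ := ((hQ z hSz).2 u).mp hu'
    exact ⟨rfl, z, hSz, hψ⟩
  · rintro ⟨rfl, z, hz, hψ⟩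
    have hz' := (hP.2 z).mpr hz
    exact ⟨z, hz', ((hQ' z hz').2 u).mpr ⟨u, ((hQ z hz).2 u).mpr ⟨rfl, hψ⟩, .halt u⟩⟩

theorem Spec.seq {P Q : Program Γ σ} {x y z : Memory Γ σ} {T T' : ℕ} {φ ψ : Prop}
    (hP : P.Spec x T φ y) (hQ : φ → Q.Spec y T' ψ z) : (P.seq Q).Spec x (T + T') (φ ∧ ψ) z :=
  (Runs.seq (ψ := fun _ => ψ) hP (by rintro _ ⟨rfl, hφ⟩; exact hQ hφ)).congr (by simp)

/-- Repeat: execute a statement, stop if it jumps to `false`, and run the program and start again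
if it jumps to `true`. -/
def loop (t : Stmt Γ Bool σ) (P : Program Γ σ) : Program Γ σ where
  Λ := Option P.Λ
  main := none
  code l := l.elim [Stmt.select (exitTo (some (some P.main))) (exitTo none) t]
    fun l => (P.code l).map (Stmt.relabel some (exitTo (some none)))

/-- Execute a statement, and run the program if it jumps to `true`. -/
def when (t : Stmt Γ Bool σ) (P : Program Γ σ) : Program Γ σ where
  Λ := Option P.Λ
  main := none
  code l := l.elim [Stmt.select (exitTo (some (some P.main))) (exitTo none) t]
    fun l => (P.code l).map (Stmt.relabel some (exitTo none))

/-- Execute a statement, over and over again while it jumps to `true`. -/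
def iterate (t : Stmt Γ Bool σ) : Program Γ σ where
  Λ := Unit
  main := ()
  code _ := [Stmt.select (exitTo (some ())) (exitTo none) t]

/-- Execute a statement, and abort if it jumps to `false`. -/
def assert (t : Stmt Γ Bool σ) : Program Γ σ where
  Λ := Bool
  main := true
  code l := if l then [Stmt.select (exitTo none) (exitTo (some false)) t] else []

section Rules

variable {P : Program Γ σ} {t : Stmt Γ Bool σ} {x y z : Memory Γ σ} {T T' : ℕ} {φ ψ : Prop}

omit [DecidableEq K] in
theorem Deterministic.loop (h : P.Deterministic) : (loop t P).Deterministic := by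
  rintro (_ | l)
  · simp [Program.loop]
  · simpa [Program.loop] using h l

omit [DecidableEq K] in
theorem Deterministic.when (h : P.Deterministic) : (when t P).Deterministic := by
  rintro (_ | l)
  · simp [Program.when]
  · simpa [Program.when] using h l

omit [DecidableEq K] in
theorem deterministic_iterate : (iterate t).Deterministic := by
  rintro l
  simp [iterate]

omit [DecidableEq K] in
theorem deterministic_assert : (assert t).Deterministic := by
  rintro (_ | _) <;> simp [assert]

/-- The first step of a program whose first label tests a condition. -/
theorem spec_of_test {e e' : Option P.Λ}
    (hmain : P.code P.main = [Stmt.select (exitTo e) (exitTo e') t]) {b : Bool}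
    (ht : exec t x = Cfg.of (some b) z)
    (h : Terminates P.code T (Cfg.of (cond b e e') z) ∧
      ∀ u, Halts P.code (Cfg.of (cond b e e') z) u ↔ u = y ∧ φ) :
    P.Spec x (T + 1) φ y := by
  have key : exec (Stmt.select (exitTo e) (exitTo e') t) x = Cfg.of (cond b e e') z := by
    rw [exec_select _ _ _ _ _ _ ht]
    cases b <;> exact exec_exitTo _ _
  refine ⟨.step T _ x ?_, fun u => ?_⟩
  · simpa [hmain, key] using h.1
  · refine halts_some_iff.trans (Iff.trans ?_ (h.2 u))
    simp [hmain, key]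

theorem spec_iterate_done (ht : exec t x = Cfg.of (some false) y) :
    (iterate t).Spec x 1 True y :=
  spec_of_test (T := 0) rfl ht ⟨.halt 0 y, fun u => (halts_none_iff (x := y)).trans (by simp)⟩

theorem spec_iterate_step (ht : exec t x = Cfg.of (some true) z)
    (h : (iterate t).Spec z T φ y) : (iterate t).Spec x (T + 1) φ y :=
  spec_of_test rfl ht h

/-- A failed test jumps to the label `false`, which has no statements: the computation gets stuck
without halting. The second unit of time is charged for that label. -/
theorem spec_assert {b : Bool} (ht : exec t x = Cfg.of (some b) y) :
    (assert t).Spec x 2 (b = true) y := by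
  refine spec_of_test (T := 1) (e := none) (e' := some false) rfl ht ?_
  cases b
  · have hcode : (assert t).code false = [] := rfl
    refine ⟨.step 0 _ y (fun q hq => by rw [hcode] at hq; simp at hq), fun u => ?_⟩
    refine (halts_some_iff (code := (assert t).code) (l := false)).trans ?_
    rw [hcode]
    simp
  · exact ⟨.halt 1 y, fun u => (halts_none_iff (x := y)).trans (by simp)⟩

theorem spec_when_false (ht : exec t x = Cfg.of (some false) y) :
    (when t P).Spec x 1 True y :=
  spec_of_test (P := when t P) (T := 0) rfl ht ⟨.halt 0 y, fun u => (halts_none_iff (x := y)).trans (by simp)⟩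

theorem spec_when_true (ht : exec t x = Cfg.of (some true) z) (h : P.Spec z T φ y) :
    (when t P).Spec x (T + 1) φ y := by
  have key := h.1.bind (code' := (when t P).code) some none (fun _ => rfl)
    (T' := 0) (fun y _ => .halt 0 y)
  refine spec_of_test (P := when t P) rfl ht ⟨key.1, fun u => (key.2 u).trans ?_⟩
  refine Iff.trans ?_ (h.2 u)
  simp [halts_none_iff]

theorem spec_loop_done (ht : exec t x = Cfg.of (some false) y) :
    (loop t P).Spec x 1 True y :=
  spec_of_test (P := loop t P) (T := 0) rfl ht ⟨.halt 0 y, fun u => (halts_none_iff (x := y)).trans (by simp)⟩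

theorem spec_loop_step {z' : Memory Γ σ} (ht : exec t x = Cfg.of (some true) z)
    (h : P.Spec z T φ z') (h' : φ → (loop t P).Spec z' T' ψ y) :
    (loop t P).Spec x (T + T' + 1) (φ ∧ ψ) y := by
  have key := h.1.bind (code' := (loop t P).code) some (some none) (fun _ => rfl)
    (T' := T') (fun u hu => by
      obtain ⟨rfl, hφ⟩ := (h.2 u).mp hu
      exact (h' hφ).1)
  refine spec_of_test (P := loop t P) rfl ht ⟨key.1, fun u => (key.2 u).trans ?_⟩
  constructor
  · rintro ⟨v, hv, hu⟩
    obtain ⟨rfl, hφ⟩ := (h.2 v).mp hv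
    obtain ⟨rfl, hψ⟩ := ((h' hφ).2 u).mp hu
    exact ⟨rfl, hφ, hψ⟩
  · rintro ⟨rfl, hφ, hψ⟩
    exact ⟨z', (h.2 z').mpr ⟨rfl, hφ⟩, ((h' hφ).2 u).mpr ⟨rfl, hψ⟩⟩

end Rules

end Program

/-! ### The given machine as a subroutine. -/

/-- The stacks that a machine for the overgroup has in addition to those of the given machine:
the unread and the read part of the input, the two counters of a zigzag encoding, an auxiliary
counter and the absolute values of three signed counters. -/
inductive WorkStack
  | input
  | done
  | fst
  | snd
  | aux
  | ctr (i : Fin 3)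
  deriving DecidableEq, Fintype

/-- A finite memory: the letter popped last, the direction of the zigzag encoding, the sign of the
row, an orientation, and the signs of the three signed counters. -/
structure Flags where
  cur : Option (Fin 4 × Bool)
  dir : Bool
  neg : Bool
  f : Bool
  sg : Fin 3 → Bool
  deriving Fintype

namespace NTM

variable {A : Type} (M : NTM A)

instance : Finite M.K := M.finiteK
instance (k : M.K) : Finite (M.Γ k) := M.finiteΓ k
instance : Finite M.Λ := M.finiteΛ
instance : Finite M.σ := M.finiteσ

/-- The alphabets of the stacks of the given machine and of the additional stacks. -/
abbrev StackSymbol : M.K ⊕ WorkStack → Type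
  | .inl k => M.Γ k
  | .inr _ => Fin 4 × Bool

/-- Programs that have access to the stacks of the given machine and to additional stacks. -/
abbrev Extended : Type := Memory M.StackSymbol (M.σ × Flags)

/-- The contents of all stacks. -/
def join (S : ∀ k, List (M.Γ k)) (W : WorkStack → List (Fin 4 × Bool)) :
    ∀ k, List (M.StackSymbol k)
  | .inl k => S k
  | .inr w => W w

theorem update_join_inl (S : ∀ k, List (M.Γ k)) (W : WorkStack → List (Fin 4 × Bool)) (k : M.K)
    (s : List (M.Γ k)) :
    Function.update (M.join S W) (.inl k) s = M.join (Function.update S k s) W := by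
  funext i
  rcases i with i | i
  · by_cases h : i = k
    · subst h; simp [join]
    · rw [Function.update_of_ne (by simpa using h)]
      simp [join, h]
  · rw [Function.update_of_ne (by simp)]; rfl

theorem update_join_inr (S : ∀ k, List (M.Γ k)) (W : WorkStack → List (Fin 4 × Bool))
    (k : WorkStack) (s : List (Fin 4 × Bool)) :
    Function.update (M.join S W) (.inr k) s = M.join S (Function.update W k s) := by
  funext i
  rcases i with i | i
  · rw [Function.update_of_ne (by simp)]; rfl
  · by_cases h : i = k
    · subst h; simp [join]
    · rw [Function.update_of_ne (by simpa using h)]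
      simp [join, h]

/-- A statement of the given machine, as a statement that ignores the additional stacks. -/
def liftStmt : Stmt M.Γ M.Λ M.σ → Stmt M.StackSymbol M.Λ (M.σ × Flags)
  | .push k u q => .push (.inl k) (fun v => u v.1) (liftStmt q)
  | .peek k u q => .peek (.inl k) (fun v o => (u v.1 o, v.2)) (liftStmt q)
  | .pop k u q => .pop (.inl k) (fun v o => (u v.1 o, v.2)) (liftStmt q)
  | .load u q => .load (fun v => (u v.1, v.2)) (liftStmt q)
  | .branch u q r => .branch (fun v => u v.1) (liftStmt q) (liftStmt r)
  | .goto u => .goto fun v => u v.1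
  | .halt => .halt

/-- The memory of the given machine, extended by the additional data. -/
def extend (a : Flags) (W : WorkStack → List (Fin 4 × Bool)) (x : Memory M.Γ M.σ) : M.Extended :=
  ((x.1, a), M.join x.2 W)

theorem exec_liftStmt (a : Flags) (W : WorkStack → List (Fin 4 × Bool)) (q : Stmt M.Γ M.Λ M.σ)
    (x : Memory M.Γ M.σ) :
    exec (M.liftStmt q) (M.extend a W x) =
      Cfg.of (exec q x).l (M.extend a W ((exec q x).var, (exec q x).stk)) := by
  obtain ⟨v, S⟩ := x
  unfold exec extend
  induction q generalizing v S with
  | push k u q ih =>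
    simp only [liftStmt, stepAux, update_join_inl]; exact ih _ _
  | peek k u q ih => simp only [liftStmt, stepAux]; exact ih _ _
  | pop k u q ih => simp only [liftStmt, stepAux, update_join_inl]; exact ih _ _
  | load u q ih => simp only [liftStmt, stepAux]; exact ih _ _
  | branch u q r ih ih' =>
    simp only [liftStmt, stepAux]
    cases u v
    · exact ih' _ _
    · exact ih _ _
  | goto u => rfl
  | halt => rfl

/-- The given machine, as a program that ignores the additional stacks. -/
def toProgram : Program M.StackSymbol (M.σ × Flags) where
  Λ := M.Λ
  main := M.main
  code l := (M.prog l).map M.liftStmt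

theorem deterministic_toProgram (h : M.Deterministic) : M.toProgram.Deterministic := by
  intro l
  simpa [toProgram] using h l

theorem StepsIn.head {n : ℕ} {c c' c'' : M.Cfg} (h : M.Step c c') (h' : M.StepsIn n c' c'') :
    M.StepsIn (n + 1) c c'' := by
  induction h' with
  | refl c => exact .tail (.refl _) h
  | tail _ hs ih => exact .tail (ih h) hs

theorem step_of_iff (l : M.Λ) (x : Memory M.Γ M.σ) (c : M.Cfg) :
    M.Step (Cfg.of (some l) x) c ↔ ∃ q ∈ M.prog l, c = exec q x := by
  constructor
  · rintro ⟨l', hl, q, hq, rfl⟩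
    simp only [Cfg.of, Option.some.injEq] at hl
    subst hl
    exact ⟨q, hq, rfl⟩
  · rintro ⟨q, hq, rfl⟩
    exact ⟨l, rfl, q, hq, rfl⟩

theorem StepsIn.cases_head {n : ℕ} {c c'' : M.Cfg} (h : M.StepsIn (n + 1) c c'') :
    ∃ c', M.Step c c' ∧ M.StepsIn n c' c'' := by
  induction n generalizing c'' with
  | zero =>
    cases h with
    | tail h hs =>
      cases h
      exact ⟨_, hs, .refl _⟩
  | succ n ih =>
    cases h with
    | tail h hs =>
      obtain ⟨c', h1, h2⟩ := ih h
      exact ⟨c', h1, .tail h2 hs⟩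

/-- The extra unit is needed because `Terminates` charges for every label, even for one without
statements, at which no step is possible. -/
theorem terminates_of_bound (T : ℕ) (c : M.Cfg) (h : ∀ n c', M.StepsIn n c c' → n ≤ T) :
    Terminates M.prog (T + 1) c := by
  induction T generalizing c with
  | zero =>
    obtain ⟨_ | l, v, S⟩ := c
    · exact .halt _ (v, S)
    · refine .step 0 l (v, S) fun q hq => absurd (h 1 (exec q (v, S)) (.head M ?_ (.refl _)))
        (by simp)
      exact (M.step_of_iff l (v, S) _).mpr ⟨q, hq, rfl⟩
  | succ T ih =>
    obtain ⟨_ | l, v, S⟩ := c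
    · exact .halt _ (v, S)
    · refine .step (T + 1) l (v, S) fun q hq => ih _ fun n c' hc' => ?_
      have := h (n + 1) c' (.head M ((M.step_of_iff l (v, S) _).mpr ⟨q, hq, rfl⟩) hc')
      omega

theorem stepsIn_le_of_terminates {T : ℕ} {c : M.Cfg} (h : Terminates M.prog T c) (n : ℕ)
    (c' : M.Cfg) (hc : M.StepsIn n c c') : n ≤ T := by
  induction h generalizing n with
  | halt T x =>
    cases n with
    | zero => omega
    | succ n =>
      obtain ⟨c', ⟨l, hl, _⟩, _⟩ := hc.cases_head
      simp [Cfg.of] at hl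
  | step T l x h ih =>
    cases n with
    | zero => omega
    | succ n =>
      obtain ⟨c', h1, h2⟩ := hc.cases_head
      obtain ⟨q, hq, rfl⟩ := (M.step_of_iff l x c').mp h1
      have := ih q hq n h2
      omega

theorem halts_iff_stepsIn (c : M.Cfg) (x : Memory M.Γ M.σ) :
    Halts M.prog c x ↔ ∃ n, M.StepsIn n c (Cfg.of none x) := by
  constructor
  · intro h
    induction h with
    | halt x => exact ⟨0, .refl _⟩
    | step l x y q hq h ih =>
      obtain ⟨n, hn⟩ := ih
      exact ⟨n + 1, .head M ((M.step_of_iff l x _).mpr ⟨q, hq, rfl⟩) hn⟩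
  · rintro ⟨n, hn⟩
    induction n generalizing c with
    | zero =>
      cases hn
      exact .halt x
    | succ n ih =>
      obtain ⟨c', h1, h2⟩ := hn.cases_head
      obtain ⟨_ | l, v, S⟩ := c
      · obtain ⟨l, hl, _⟩ := h1
        simp at hl
      · obtain ⟨q, hq, rfl⟩ := (M.step_of_iff l (v, S) c').mp h1
        exact .step l (v, S) x q hq (ih _ h2)

theorem terminates_lift (a : Flags) (W : WorkStack → List (Fin 4 × Bool)) {T : ℕ} {c : M.Cfg}
    (h : Terminates M.prog T c) :
    Terminates M.toProgram.code T (Cfg.of c.l (M.extend a W (c.var, c.stk))) ∧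
      ∀ z, Halts M.toProgram.code (Cfg.of c.l (M.extend a W (c.var, c.stk))) z ↔
        ∃ x, Halts M.prog c x ∧ z = M.extend a W x := by
  induction h with
  | halt T x =>
    refine ⟨.halt T _, fun z => halts_none_iff.trans ?_⟩
    simp only [halts_none_iff, exists_eq_left]
    rfl
  | step T l x h ih =>
    have ih (q) (hq : q ∈ M.prog l) := M.exec_liftStmt a W q x ▸ ih q hq
    refine ⟨.step T l _ fun q' hq' => ?_, fun z => (halts_some_iff (l := l)).trans ?_⟩
    · obtain ⟨q, hq, rfl⟩ := List.mem_map.mp hq'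
      exact (ih q hq).1
    · constructor
      · rintro ⟨q', hq', hz⟩
        obtain ⟨q, hq, rfl⟩ := List.mem_map.mp hq'
        obtain ⟨y, hy, rfl⟩ := ((ih q hq).2 z).mp hz
        exact ⟨y, halts_some_iff.mpr ⟨q, hq, hy⟩, rfl⟩
      · rintro ⟨y, hy, rfl⟩
        obtain ⟨q, hq, hy⟩ := halts_some_iff.mp hy
        exact ⟨_, List.mem_map_of_mem hq, ((ih q hq).2 _).mpr ⟨y, hy, rfl⟩⟩

/-- The initial memory on a given input. -/
def initMemory (u : List A) : Memory M.Γ M.σ := (M.start, (M.init u).stk)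

theorem runs_toProgram (a : Flags) (W : WorkStack → List (Fin 4 × Bool)) (u : List A) {T : ℕ}
    (h : ∀ n c, M.StepsIn n (M.init u) c → n ≤ T) :
    M.toProgram.Runs (M.extend a W (M.initMemory u)) (T + 1) fun z =>
      ∃ x, (∃ n, M.StepsIn n (M.init u) (Cfg.of none x)) ∧ z = M.extend a W x := by
  have := M.terminates_lift a W (M.terminates_of_bound T _ h)
  refine ⟨this.1, fun z => (this.2 z).trans ?_⟩
  simp only [halts_iff_stepsIn]

end NTM

/-! ### Stack growth, cleaning up and querying. -/

namespace Turing.TM2.Stmt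

variable {K : Type} [DecidableEq K] {Γ : K → Type} {σ Λ : Type}

/-- An upper bound for the number of letters that a statement can push. -/
def size : Stmt Γ Λ σ → ℕ
  | push _ _ q => size q + 1
  | peek _ _ q => size q
  | pop _ _ q => size q
  | load _ q => size q
  | branch _ q r => size q + size r
  | goto _ => 0
  | halt => 0

theorem length_exec_le (q : Stmt Γ Λ σ) (x : Memory Γ σ) (k : K) :
    ((exec q x).stk k).length ≤ (x.2 k).length + q.size := by
  obtain ⟨v, S⟩ := x
  unfold exec
  induction q generalizing v S with
  | push k' u q ih =>
    have key := ih v (Function.update S k' (u v :: S k'))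
    simp only [stepAux, size] at key ⊢
    rcases eq_or_ne k k' with rfl | h
    · rw [Function.update_self, List.length_cons] at key; omega
    · rw [Function.update_of_ne h] at key; omega
  | peek k' u q ih => simp only [stepAux]; exact ih _ _
  | pop k' u q ih =>
    have key := ih (u v (S k').head?) (Function.update S k' (S k').tail)
    simp only [stepAux, size] at key ⊢
    rcases eq_or_ne k k' with rfl | h
    · rw [Function.update_self, List.length_tail] at key; omega
    · rw [Function.update_of_ne h] at key; omega
  | load u q ih => simp only [stepAux]; exact ih _ _
  | branch u q r ih ih' =>
    have h1 := ih v S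
    have h2 := ih' v S
    simp only [stepAux, size] at h1 h2 ⊢
    cases u v
    · rw [cond_false]; omega
    · rw [cond_true]; omega
  | goto u => simp [stepAux]
  | halt => simp [stepAux]

end Turing.TM2.Stmt

namespace NTM

variable {A : Type} (M : NTM A)

theorem exists_size_le : ∃ C, ∀ l, ∀ q ∈ M.prog l, q.size ≤ C := by
  obtain ⟨C, hC⟩ := (Set.finite_range fun l => ((M.prog l).map Stmt.size).sum).bddAbove
  exact ⟨C, fun l q hq => (List.le_sum_of_mem (List.mem_map_of_mem hq)).trans
    (hC (Set.mem_range_self l))⟩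

/-- A time bound gives a bound on the stacks, and hence on the time for emptying them after a query.
-/
theorem length_le_of_stepsIn {C : ℕ} (hC : ∀ l, ∀ q ∈ M.prog l, q.size ≤ C) {n : ℕ}
    {c c' : M.Cfg} (h : M.StepsIn n c c') (k : M.K) :
    (c'.stk k).length ≤ (c.stk k).length + n * C := by
  induction h with
  | refl c => simp
  | @tail n c c' c'' h hs ih =>
    obtain ⟨l, -, q, hq, rfl⟩ := hs
    refine (q.length_exec_le (c'.var, c'.stk) k).trans ?_
    have := hC l q hq
    rw [add_mul]
    simp only
    omega

theorem length_init_le (u : List A) (k : M.K) : ((M.init u).stk k).length ≤ u.length := by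
  by_cases h : k = M.k₀
  · subst h; simp [init]
  · simp [init, h]

noncomputable section

open Classical in
/-- The test whether the internal state of the given machine is accepting. -/
def acceptStmt : Stmt M.StackSymbol Bool (M.σ × Flags) :=
  .goto fun v => decide (v.1 ∈ M.accepting)

/-- Pop one letter from each stack of a list, and record whether there was any letter. -/
def popAll (ks : List M.K) : Stmt M.StackSymbol Bool (M.σ × Flags) :=
  ks.foldr (fun k q => .pop (.inl k)
    (fun v o => (v.1, { v.2 with cur := if o.isSome then some default else v.2.cur })) q)
    (.goto fun v => v.2.cur.isSome)

theorem exec_popAll (ks : List M.K) (hks : ks.Nodup) (W : WorkStack → List (Fin 4 × Bool))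
    (a : Flags) (v : M.σ) (S : ∀ k, List (M.Γ k)) :
    ∃ o : Option (Fin 4 × Bool), (o.isSome ↔ a.cur.isSome ∨ ∃ k ∈ ks, S k ≠ []) ∧
      (o.isSome = false → o = none) ∧
      exec (M.popAll ks) (M.extend a W (v, S)) = Cfg.of (some o.isSome)
        (M.extend { a with cur := o } W (v, fun k => if k ∈ ks then (S k).tail else S k)) := by
  induction ks generalizing a S with
  | nil => exact ⟨a.cur, by simp, by simp, by simp [popAll, exec, extend, Cfg.of]⟩
  | cons k ks ih =>
    obtain ⟨hk, hks⟩ := List.nodup_cons.mp hks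
    obtain ⟨o, h1, h2, h3⟩ := ih hks
      { a with cur := if (S k).head?.isSome then some default else a.cur }
      (Function.update S k (S k).tail)
    refine ⟨o, ?_, h2, ?_⟩
    · rw [h1]
      have e1 : (∃ k' ∈ ks, Function.update S k (S k).tail k' ≠ []) ↔ ∃ k' ∈ ks, S k' ≠ [] := by
        refine exists_congr fun k' => and_congr_right fun hk' => ?_
        rw [Function.update_of_ne (by rintro rfl; exact hk hk')]
      rw [e1]
      rcases hS : S k with _ | ⟨s, s'⟩ <;> simp [hS]
    · have e2 : exec (M.popAll (k :: ks)) (M.extend a W (v, S)) =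
          exec (M.popAll ks) (M.extend
            { a with cur := if (S k).head?.isSome then some default else a.cur } W
            (v, Function.update S k (S k).tail)) := by
        simp only [exec, popAll, extend, List.foldr_cons, stepAux, update_join_inl]
        rfl
      rw [e2, h3]
      congr 3
      funext k'
      by_cases h : k' = k
      · subst h; simp [hk]
      · simp [h]

/-- Pop one letter from each stack of the given machine. -/
def cleanStmt : Stmt M.StackSymbol Bool (M.σ × Flags) :=
  .load (fun v => (M.start, { v.2 with cur := none }))
    (M.popAll (@Finset.univ M.K (Fintype.ofFinite _)).toList)

theorem exec_cleanStmt (W : WorkStack → List (Fin 4 × Bool)) (a : Flags) (v : M.σ)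
    (S : ∀ k, List (M.Γ k)) :
    ∃ o : Option (Fin 4 × Bool), (o.isSome ↔ ∃ k, S k ≠ []) ∧
      exec M.cleanStmt (M.extend a W (v, S)) = Cfg.of (some o.isSome)
        (M.extend { a with cur := o } W (M.start, fun k => (S k).tail)) := by
  let _ : Fintype M.K := Fintype.ofFinite _
  obtain ⟨o, h1, -, h3⟩ := M.exec_popAll Finset.univ.toList (Finset.nodup_toList _) W
    { a with cur := none } M.start S
  refine ⟨o, by simpa using h1, ?_⟩
  simp only [Finset.mem_toList, Finset.mem_univ, if_true] at h3
  exact h3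

theorem spec_clean (B : ℕ) (W : WorkStack → List (Fin 4 × Bool)) (a : Flags) (v : M.σ)
    (S : ∀ k, List (M.Γ k)) (hS : ∀ k, (S k).length ≤ B) :
    (Program.iterate M.cleanStmt).Spec (M.extend a W (v, S)) (B + 1) True
      (M.extend { a with cur := none } W (M.initMemory [])) := by
  have hinit : M.initMemory [] = (M.start, fun _ => []) := by
    simp [initMemory, init]
  rw [hinit]
  induction B generalizing a v S with
  | zero =>
    obtain ⟨o, h1, h2⟩ := M.exec_cleanStmt W a v S
    have hS' : ∀ k, S k = [] := fun k => by simpa using hS k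
    obtain rfl : o = none := by
      rw [← Option.not_isSome_iff_eq_none, h1]; simpa using hS'
    simp only [hS', List.tail_nil] at h2
    exact Program.spec_iterate_done h2
  | succ B ih =>
    obtain ⟨o, h1, h2⟩ := M.exec_cleanStmt W a v S
    cases o with
    | none =>
      have hS' : ∀ k, S k = [] := by simpa using h1
      simp only [hS', List.tail_nil] at h2
      exact (Program.spec_iterate_done h2).mono (by omega)
    | some s =>
      exact Program.spec_iterate_step h2 (ih { a with cur := some s } _ _ fun k => by
        have := hS k
        simp only [List.length_tail]
        omega)

/-- Run the given machine, abort unless it accepts, and restore its initial configuration with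
empty input. -/
def query : Program M.StackSymbol (M.σ × Flags) :=
  M.toProgram.seq ((Program.assert M.acceptStmt).seq
    (Program.iterate M.cleanStmt))

theorem deterministic_query (h : M.Deterministic) : M.query.Deterministic :=
  (M.deterministic_toProgram h).seq
    (Program.deterministic_assert.seq Program.deterministic_iterate)

/-- Accepting computations may leave different garbage behind. Cleaning makes their outcomes equal,
so only the condition `M.Accepts u` remains of the nondeterminism. -/
theorem spec_query {C : ℕ} (hC : ∀ l, ∀ q ∈ M.prog l, q.size ≤ C)
    (W : WorkStack → List (Fin 4 × Bool)) (a : Flags) (u : List A) {T : ℕ}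
    (h : ∀ n c, M.StepsIn n (M.init u) c → n ≤ T) :
    M.query.Spec (M.extend a W (M.initMemory u)) (T + 1 + (2 + (u.length + T * C + 1)))
      (M.Accepts u) (M.extend { a with cur := none } W (M.initMemory [])) := by
  refine (Program.Runs.seq (M.runs_toProgram a W u h)
    (ψ := fun z => z.1.1 ∈ M.accepting ∧ True) ?_).congr ?_
  · rintro _ ⟨x, ⟨n, hn⟩, rfl⟩
    classical
    have ht : exec M.acceptStmt (M.extend a W x) =
        Cfg.of (some (decide (x.1 ∈ M.accepting))) (M.extend a W x) := by
      simp [exec, acceptStmt, extend, Cfg.of]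
    refine ((Program.spec_assert ht).congr decide_eq_true_iff).seq fun _ => ?_
    refine M.spec_clean _ W a x.1 x.2 fun k => ?_
    have h1 := M.length_le_of_stepsIn hC hn k
    have h2 := M.length_init_le u k
    have h3 := Nat.mul_le_mul_right C (h n _ hn)
    exact h1.trans (by omega)
  · constructor
    · rintro ⟨_, ⟨x, ⟨n, hn⟩, rfl⟩, hx, -⟩
      exact ⟨n, _, hn, rfl, hx⟩
    · rintro ⟨n, ⟨_ | l, v, S⟩, hn, hl, hx⟩
      · exact ⟨_, ⟨(v, S), ⟨n, hn⟩, rfl⟩, hx, trivial⟩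
      · simp at hl

end

end NTM

/-! ### Registers and signed counters. -/

namespace Zigzag

/-- Change the counter that decreases. -/
def withSource (z : Zigzag) (x : ℕ) : Zigzag :=
  ⟨z.dir, if z.dir then z.a else x, if z.dir then x else z.b⟩

theorem withSource_source (z : Zigzag) : z.withSource z.source = z := by
  obtain ⟨_ | _, a, b⟩ := z <;> rfl

end Zigzag

/-- The data that the machine for the overgroup keeps between two runs of the given machine. -/
structure Registers where
  input : List (Fin 4 × Bool)
  done : List (Fin 4 × Bool)
  z : Zigzag
  aux : ℕ
  ctr : Fin 3 → ℤ
  cur : Option (Fin 4 × Bool)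
  neg : Bool
  f : Bool
  out : List (Fin 2 × Bool)

namespace Registers

def flags (r : Registers) : Flags where
  cur := r.cur
  dir := r.z.dir
  neg := r.neg
  f := r.f
  sg i := decide (r.ctr i < 0)

def work (r : Registers) : WorkStack → List (Fin 4 × Bool)
  | .input => r.input
  | .done => r.done
  | .fst => List.replicate r.z.a default
  | .snd => List.replicate r.z.b default
  | .aux => List.replicate r.aux default
  | .ctr i => List.replicate (r.ctr i).natAbs default

variable (M : NTM (Fin 2 × Bool))

/-- The memory that stores the data. -/
def memory (r : Registers) : M.Extended := M.extend r.flags r.work (M.initMemory r.out)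

end Registers

namespace NTM

variable (M : NTM (Fin 2 × Bool)) {Λ : Type}

section Instructions

/-- Statements of the machine for the overgroup. -/
abbrev Instr (Λ : Type) : Type := Stmt M.StackSymbol Λ (M.σ × Flags)

variable {M}

def push (k : WorkStack) (q : M.Instr Λ) : M.Instr Λ := .push (.inr k) (fun _ => default) q

def pushCur (k : WorkStack) (q : M.Instr Λ) : M.Instr Λ :=
  .push (.inr k) (fun v => v.2.cur.getD default) q

def pop (k : WorkStack) (q : M.Instr Λ) : M.Instr Λ :=
  .pop (.inr k) (fun v o => (v.1, { v.2 with cur := o })) q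

def peek (k : WorkStack) (q : M.Instr Λ) : M.Instr Λ :=
  .peek (.inr k) (fun v o => (v.1, { v.2 with cur := o })) q

def modify (g : Flags → Flags) (q : M.Instr Λ) : M.Instr Λ := .load (fun v => (v.1, g v.2)) q

def cases (p : Flags → Bool) (q q' : M.Instr Λ) : M.Instr Λ := .branch (fun v => p v.2) q q'

def jump (l : Λ) : M.Instr Λ := .goto fun _ => l

/-- Push a letter on the input stack of the given machine. -/
def write (l : Fin 2 × Bool) (q : M.Instr Λ) : M.Instr Λ := .push (.inl M.k₀) (fun _ => M.input l) q

variable (q q' : M.Instr Λ) (a : Flags) (W : WorkStack → List (Fin 4 × Bool))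
  (x : Memory M.Γ M.σ) (k : WorkStack)

theorem exec_push : exec (push k q) (M.extend a W x) =
    exec q (M.extend a (Function.update W k (default :: W k)) x) := by
  simp only [exec, push, extend, stepAux, update_join_inr]
  rfl

theorem exec_pushCur : exec (pushCur k q) (M.extend a W x) =
    exec q (M.extend a (Function.update W k (a.cur.getD default :: W k)) x) := by
  simp only [exec, pushCur, extend, stepAux, update_join_inr]
  rfl

theorem exec_pop : exec (pop k q) (M.extend a W x) =
    exec q (M.extend { a with cur := (W k).head? } (Function.update W k (W k).tail) x) := by
  simp only [exec, pop, extend, stepAux, update_join_inr]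
  rfl

theorem exec_peek : exec (peek k q) (M.extend a W x) =
    exec q (M.extend { a with cur := (W k).head? } W x) := rfl

theorem exec_modify (g : Flags → Flags) : exec (modify g q) (M.extend a W x) =
    exec q (M.extend (g a) W x) := rfl

theorem exec_cases (p : Flags → Bool) : exec (cases p q q') (M.extend a W x) =
    if p a then exec q (M.extend a W x) else exec q' (M.extend a W x) := by
  simp only [exec, cases, extend, stepAux]
  cases p a <;> rfl

theorem exec_jump (l : Λ) (x : M.Extended) : exec (jump l : M.Instr Λ) x = Cfg.of (some l) x := rfl

theorem exec_write (l : Fin 2 × Bool) (u : List (Fin 2 × Bool)) :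
    exec (write l q) (M.extend a W (M.initMemory u)) =
      exec q (M.extend a W (M.initMemory (l :: u))) := by
  simp only [exec, write, extend, stepAux, update_join_inl]
  congr 2
  simp [initMemory, init, join]

end Instructions

section Registers

variable {M} (q q' : M.Instr Λ) (r : Registers)

/-- Forget the letter popped last. -/
def forget (q : M.Instr Λ) : M.Instr Λ := modify (fun a => { a with cur := none }) q

theorem exec_forget : exec (forget q) (r.memory M) =
    exec q ({ r with cur := none }.memory M) := rfl

theorem exec_cases_memory (p : Flags → Bool) : exec (cases p q q') (r.memory M) =
    exec (if p r.flags then q else q') (r.memory M) := by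
  unfold Registers.memory
  rw [exec_cases]
  split_ifs <;> rfl

theorem exec_write_memory (l : Fin 2 × Bool) : exec (write l q) (r.memory M) =
    exec q ({ r with out := l :: r.out }.memory M) := exec_write _ _ _ _ _

theorem exec_pop_input : exec (pop .input q) (r.memory M) =
    exec q ({ r with cur := r.input.head?, input := r.input.tail }.memory M) := by
  unfold Registers.memory
  rw [exec_pop]
  congr 2
  funext k
  cases k <;> simp [Registers.work]

theorem exec_pop_done : exec (pop .done q) (r.memory M) =
    exec q ({ r with cur := r.done.head?, done := r.done.tail }.memory M) := by
  unfold Registers.memory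
  rw [exec_pop]
  congr 2
  funext k
  cases k <;> simp [Registers.work]

theorem exec_pushCur_input : exec (pushCur .input q) (r.memory M) =
    exec q ({ r with input := r.cur.getD default :: r.input }.memory M) := by
  unfold Registers.memory
  rw [exec_pushCur]
  congr 2
  funext k
  cases k <;> simp [Registers.work, Registers.flags]

theorem exec_pushCur_done : exec (pushCur .done q) (r.memory M) =
    exec q ({ r with done := r.cur.getD default :: r.done }.memory M) := by
  unfold Registers.memory
  rw [exec_pushCur]
  congr 2
  funext k
  cases k <;> simp [Registers.work, Registers.flags]

theorem head?_replicate_default (n : ℕ) :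
    (List.replicate n (default : Fin 4 × Bool)).head? = if n = 0 then none else some default := by
  cases n <;> simp [List.replicate_succ]

theorem exec_pop_aux : exec (pop .aux q) (r.memory M) =
    exec q ({ r with cur := if r.aux = 0 then none else some default, aux := r.aux - 1 }.memory M)
      := by
  unfold Registers.memory
  rw [exec_pop]
  congr 2
  · simp [Registers.work, Registers.flags, head?_replicate_default]
  · funext k
    cases k <;> simp [Registers.work]

theorem exec_push_aux : exec (push .aux q) (r.memory M) =
    exec q ({ r with aux := r.aux + 1 }.memory M) := by
  unfold Registers.memory
  rw [exec_push]
  congr 2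
  funext k
  cases k <;> simp [Registers.work, List.replicate_succ]

theorem exec_push_fst : exec (push .fst q) (r.memory M) =
    exec q ({ r with z := { r.z with a := r.z.a + 1 } }.memory M) := by
  unfold Registers.memory
  rw [exec_push]
  congr 2
  funext k
  cases k <;> simp [Registers.work, List.replicate_succ]

theorem exec_push_snd : exec (push .snd q) (r.memory M) =
    exec q ({ r with z := { r.z with b := r.z.b + 1 } }.memory M) := by
  unfold Registers.memory
  rw [exec_push]
  congr 2
  funext k
  cases k <;> simp [Registers.work, List.replicate_succ]

theorem exec_pop_fst : exec (pop .fst q) (r.memory M) =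
    exec q ({ r with
      cur := if r.z.a = 0 then none else some default,
      z := { r.z with a := r.z.a - 1 } }.memory M) := by
  unfold Registers.memory
  rw [exec_pop]
  congr 2
  · simp [Registers.work, Registers.flags, head?_replicate_default]
  · funext k
    cases k <;> simp [Registers.work]

theorem exec_pop_snd : exec (pop .snd q) (r.memory M) =
    exec q ({ r with
      cur := if r.z.b = 0 then none else some default,
      z := { r.z with b := r.z.b - 1 } }.memory M) := by
  unfold Registers.memory
  rw [exec_pop]
  congr 2
  · simp [Registers.work, Registers.flags, head?_replicate_default]
  · funext k
    cases k <;> simp [Registers.work]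

theorem exec_peek_fst : exec (peek .fst q) (r.memory M) =
    exec q ({ r with cur := if r.z.a = 0 then none else some default }.memory M) := by
  unfold Registers.memory
  rw [exec_peek]
  congr 2
  simp [Registers.work, Registers.flags, head?_replicate_default]

theorem exec_peek_snd : exec (peek .snd q) (r.memory M) =
    exec q ({ r with cur := if r.z.b = 0 then none else some default }.memory M) := by
  unfold Registers.memory
  rw [exec_peek]
  congr 2
  simp [Registers.work, Registers.flags, head?_replicate_default]

theorem exec_peek_ctr (i : Fin 3) : exec (peek (.ctr i) q) (r.memory M) =
    exec q ({ r with cur := if r.ctr i = 0 then none else some default }.memory M) := by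
  unfold Registers.memory
  rw [exec_peek]
  congr 2
  simp [Registers.work, Registers.flags, head?_replicate_default]

/-- Change the direction of the zigzag encoding. -/
def turn (q : M.Instr Λ) : M.Instr Λ := modify (fun a => { a with dir := !a.dir }) q

theorem exec_turn : exec (turn q) (r.memory M) =
    exec q ({ r with z := { r.z with dir := !r.z.dir } }.memory M) := by
  unfold Registers.memory turn
  rw [exec_modify]
  congr 2

def setNeg (b : Bool) (q : M.Instr Λ) : M.Instr Λ := modify (fun a => { a with neg := b }) q

theorem exec_setNeg (b : Bool) : exec (setNeg b q) (r.memory M) =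
    exec q ({ r with neg := b }.memory M) := rfl

def flipOrientation (q : M.Instr Λ) : M.Instr Λ := modify (fun a => { a with f := !a.f }) q

theorem exec_flipOrientation : exec (flipOrientation q) (r.memory M) =
    exec q ({ r with f := !r.f }.memory M) := rfl

/-- Test whether a signed counter is zero. -/
def ifCtrZero (i : Fin 3) (q q' : M.Instr Λ) : M.Instr Λ :=
  peek (.ctr i) (cases (fun a => a.cur.isNone) (forget q) (forget q'))

theorem exec_ifCtrZero (i : Fin 3) : exec (ifCtrZero i q q') (r.memory M) =
    exec (if r.ctr i = 0 then q else q') ({ r with cur := none }.memory M) := by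
  rw [ifCtrZero, exec_peek_ctr, exec_cases_memory]
  by_cases h : r.ctr i = 0 <;> simp [h, Registers.flags, exec_forget]

/-- Increase the absolute value of a signed counter. -/
def growCtr (i : Fin 3) (b : Bool) (q : M.Instr Λ) : M.Instr Λ :=
  push (.ctr i) (modify (fun a => { a with sg := Function.update a.sg i b }) (forget q))

/-- Decrease the absolute value of a signed counter. -/
def shrinkCtr (i : Fin 3) (b : Bool) (q : M.Instr Λ) : M.Instr Λ :=
  pop (.ctr i) (peek (.ctr i) (cases (fun a => a.cur.isNone)
    (modify (fun a => { a with sg := Function.update a.sg i false }) (forget q))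
    (modify (fun a => { a with sg := Function.update a.sg i b }) (forget q))))

theorem exec_growCtr (i : Fin 3) (b : Bool) (x : ℤ) (hx : x.natAbs = (r.ctr i).natAbs + 1)
    (hb : b = decide (x < 0)) : exec (growCtr i b q) (r.memory M) =
      exec q ({ r with ctr := Function.update r.ctr i x, cur := none }.memory M) := by
  unfold Registers.memory growCtr forget
  rw [exec_push, exec_modify, exec_modify]
  congr 2
  · simp only [Registers.flags, hb, Flags.mk.injEq, true_and]
    funext k
    by_cases h : k = i
    · subst h; simp
    · simp [h]
  · funext k
    cases k with
    | ctr k =>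
      by_cases h : k = i
      · subst h; simp [Registers.work, hx, List.replicate_succ]
      · simp [Registers.work, h]
    | _ => simp [Registers.work]

/-- The stored sign must be `decide (x < 0)`, so zero has sign `false`. This is why the statement
peeks again after popping, and why `b` is unconstrained when `x = 0`. -/
theorem exec_shrinkCtr (i : Fin 3) (b : Bool) (x : ℤ) (hx : x.natAbs + 1 = (r.ctr i).natAbs)
    (hb : x ≠ 0 → b = decide (x < 0)) : exec (shrinkCtr i b q) (r.memory M) =
      exec q ({ r with ctr := Function.update r.ctr i x, cur := none }.memory M) := by
  have key : ∀ b', b' = decide (x < 0) → exec q (M.extend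
      { cur := none, dir := r.z.dir, neg := r.neg, f := r.f,
        sg := Function.update (fun i => decide (r.ctr i < 0)) i b' }
      (Function.update r.work (.ctr i) (List.replicate x.natAbs default)) (M.initMemory r.out)) =
      exec q ({ r with ctr := Function.update r.ctr i x, cur := none }.memory M) := by
    rintro _ rfl
    unfold Registers.memory
    congr 2
    · simp only [Registers.flags, Flags.mk.injEq, true_and]
      funext k
      by_cases h : k = i
      · subst h; simp
      · simp [h]
    · funext k
      cases k with
      | ctr k =>
        by_cases h : k = i
        · subst h; simp [Registers.work]
        · simp [Registers.work, h]
      | _ => simp [Registers.work]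
  have hwork : (r.work (.ctr i)).tail = List.replicate x.natAbs default := by
    simp [Registers.work, ← hx]
  unfold Registers.memory shrinkCtr forget
  rw [exec_pop, exec_peek, exec_cases, hwork, Function.update_self, head?_replicate_default]
  by_cases h : x = 0
  · subst h
    simpa [exec_modify, Registers.flags, Registers.memory] using key false (by simp)
  · simpa [exec_modify, Registers.flags, Registers.memory, h] using key b (hb h)

/-- Increment a signed counter. -/
def incCtr (i : Fin 3) (q : M.Instr Λ) : M.Instr Λ :=
  cases (fun a => a.sg i) (shrinkCtr i true q) (growCtr i false q)

theorem exec_incCtr (i : Fin 3) : exec (incCtr i q) (r.memory M) =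
    exec q ({ r with ctr := Function.update r.ctr i (r.ctr i + 1), cur := none }.memory M) := by
  rw [incCtr, exec_cases_memory]
  by_cases h : r.ctr i < 0
  · simp only [Registers.flags, h, decide_true, if_true]
    exact exec_shrinkCtr _ _ _ _ _ (by omega) fun h' => by simp; omega
  · simp only [Registers.flags, h, decide_false, Bool.false_eq_true, if_false]
    exact exec_growCtr _ _ _ _ _ (by omega) (by simp; omega)

/-- Decrement a signed counter. -/
def decCtr (i : Fin 3) (q : M.Instr Λ) : M.Instr Λ :=
  cases (fun a => a.sg i) (growCtr i true q)
    (ifCtrZero i (growCtr i true q) (shrinkCtr i false q))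

theorem exec_decCtr (i : Fin 3) : exec (decCtr i q) (r.memory M) =
    exec q ({ r with ctr := Function.update r.ctr i (r.ctr i - 1), cur := none }.memory M) := by
  rw [decCtr, exec_cases_memory]
  by_cases h : r.ctr i < 0
  · simp only [Registers.flags, h, decide_true, if_true]
    exact exec_growCtr _ _ _ _ _ (by omega) (by simp; omega)
  · simp only [Registers.flags, h, decide_false, Bool.false_eq_true, if_false]
    rw [exec_ifCtrZero]
    by_cases h0 : r.ctr i = 0
    · rw [if_pos h0]
      exact exec_growCtr _ _ _ _ _ (by simp only; omega) (by simp; omega)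
    · rw [if_neg h0]
      exact exec_shrinkCtr _ _ _ _ _ (by simp only; omega) fun h' => by simp; omega

/-- Change the sign of a signed counter. -/
def negCtr (i : Fin 3) (q : M.Instr Λ) : M.Instr Λ :=
  ifCtrZero i q (modify (fun a => { a with sg := Function.update a.sg i !(a.sg i) }) q)

theorem exec_negCtr (i : Fin 3) : exec (negCtr i q) (r.memory M) =
    exec q ({ r with ctr := Function.update r.ctr i (-r.ctr i), cur := none }.memory M) := by
  rw [negCtr, exec_ifCtrZero]
  by_cases h0 : r.ctr i = 0
  · rw [if_pos h0]
    congr 2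
    rw [h0, neg_zero, ← h0, Function.update_eq_self]
  · rw [if_neg h0]
    unfold Registers.memory
    rw [exec_modify]
    congr 2
    · simp only [Registers.flags, Flags.mk.injEq, true_and]
      funext k
      by_cases h : k = i
      · subst h
        simp only [Function.update_self]
        rw [← decide_not, decide_eq_decide]
        omega
      · simp [h]
    · funext k
      cases k with
      | ctr k =>
        by_cases h : k = i
        · subst h; simp [Registers.work]
        · simp [Registers.work, h]
      | _ => simp [Registers.work]

end Registers

end NTM

/-! ### Row arithmetic on zigzag counters. -/

namespace Registers

/-- The data with the row replaced. -/
def atRow (r : Registers) (n : ℤ) : Registers :=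
  { r with z := Zigzag.ofNat n.natAbs, neg := decide (n < 0) }

/-- The data that store a trace. -/
def ofTrace (input done : List (Fin 4 × Bool)) (cur : Option (Fin 4 × Bool)) (a : Trace) :
    Registers where
  input := input
  done := done
  z := Zigzag.ofNat a.n.natAbs
  aux := 0
  ctr := ![a.m, a.j, a.d]
  cur := cur
  neg := decide (a.n < 0)
  f := a.f
  out := nu a.out

end Registers

namespace NTM

variable {M : NTM (Fin 2 × Bool)} {Λ : Type} (q q' : M.Instr Λ) (r : Registers)

def incZigzag (q : M.Instr Λ) : M.Instr Λ :=
  cases (fun a => a.dir)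
    (pop .snd (push .fst (cases (fun a => a.cur.isNone) (turn (forget q)) (forget q))))
    (pop .fst (push .snd (cases (fun a => a.cur.isNone) (turn (forget q)) (forget q))))

/-- The push is unconditional: if the source counter was empty, the pop does nothing and the pushed
unit is the additional one of the next sweep. -/
theorem exec_incZigzag : exec (incZigzag q) (r.memory M) =
    exec q ({ r with z := r.z.next, cur := none }.memory M) := by
  obtain ⟨input, done, ⟨_ | _, _ | a, _ | b⟩, aux, ctr, cur, neg, f, out⟩ := r <;>
    simp [incZigzag, exec_cases_memory, exec_pop_fst, exec_pop_snd, exec_push_fst, exec_push_snd,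
      exec_turn, exec_forget, Registers.flags, Zigzag.next]

def decZigzag (q : M.Instr Λ) : M.Instr Λ :=
  cases (fun a => a.dir)
    (pop .fst (cases (fun a => a.cur.isNone) (pop .snd (turn (forget q))) (push .snd (forget q))))
    (pop .snd (cases (fun a => a.cur.isNone) (pop .fst (turn (forget q))) (push .fst (forget q))))

theorem exec_decZigzag : exec (decZigzag q) (r.memory M) =
    exec q ({ r with z := r.z.prev, cur := none }.memory M) := by
  obtain ⟨input, done, ⟨_ | _, _ | a, _ | b⟩, aux, ctr, cur, neg, f, out⟩ := r <;>
    simp [decZigzag, exec_cases_memory, exec_pop_fst, exec_pop_snd, exec_push_fst, exec_push_snd,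
      exec_turn, exec_forget, Registers.flags, Zigzag.prev]

/-- Test whether both counters of the zigzag encoding are zero. -/
def ifRowZero (q q' : M.Instr Λ) : M.Instr Λ :=
  peek .fst (cases (fun a => a.cur.isNone)
    (peek .snd (cases (fun a => a.cur.isNone) (forget q) (forget q'))) (forget q'))

theorem exec_ifRowZero : exec (ifRowZero q q') (r.memory M) =
    exec (if r.z.a = 0 ∧ r.z.b = 0 then q else q') ({ r with cur := none }.memory M) := by
  by_cases ha : r.z.a = 0 <;> by_cases hb : r.z.b = 0 <;>
    simp [ifRowZero, exec_cases_memory, exec_peek_fst, exec_peek_snd, exec_forget,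
      Registers.flags, ha, hb]

theorem exec_ifRowZero_atRow (n : ℤ) : exec (ifRowZero q q') ((r.atRow n).memory M) =
    exec (if n = 0 then q else q') (({ r with cur := none }.atRow n).memory M) := by
  rw [exec_ifRowZero]
  simp only [Registers.atRow, Zigzag.ofNat_eq_zero_iff, Int.natAbs_eq_zero]

/-- Test whether the increasing counter of the zigzag encoding is zero. -/
def ifTargetZero (q q' : M.Instr Λ) : M.Instr Λ :=
  cases (fun a => a.dir)
    (peek .fst (cases (fun a => a.cur.isNone) (forget q) (forget q')))
    (peek .snd (cases (fun a => a.cur.isNone) (forget q) (forget q')))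

theorem exec_ifTargetZero : exec (ifTargetZero q q') (r.memory M) =
    exec (if r.z.target = 0 then q else q') ({ r with cur := none }.memory M) := by
  obtain ⟨input, done, ⟨_ | _, _ | a, _ | b⟩, aux, ctr, cur, neg, f, out⟩ := r <;>
    simp [ifTargetZero, exec_cases_memory, exec_peek_fst, exec_peek_snd, exec_forget,
      Registers.flags, Zigzag.target]

/-- Increment the row. -/
def incRow (q : M.Instr Λ) : M.Instr Λ :=
  cases (fun a => a.neg) (decZigzag (ifRowZero (setNeg false q) q)) (incZigzag q)

/-- Below row `0` the absolute value decreases. On arrival at `0` the sign has to be reset, since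
row `0` is stored as nonnegative. -/
theorem exec_incRow (n : ℤ) : exec (incRow q) ((r.atRow n).memory M) =
    exec q (({ r with cur := none }.atRow (n + 1)).memory M) := by
  rw [incRow, exec_cases_memory]
  by_cases h : n < 0
  · obtain ⟨k, rfl⟩ : ∃ k : ℕ, n = -(k + 1 : ℕ) := ⟨n.natAbs - 1, by omega⟩
    have e : (-((k + 1 : ℕ) : ℤ) + 1) = -(k : ℤ) := by omega
    simp only [Registers.atRow, Registers.flags, h, decide_true, if_true]
    rw [exec_decZigzag, exec_ifRowZero, e]
    simp only [Int.natAbs_neg, Int.natAbs_natCast, Zigzag.prev_ofNat_succ,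
      Zigzag.ofNat_eq_zero_iff]
    rcases Nat.eq_zero_or_pos k with rfl | hk
    · rw [if_pos rfl, exec_setNeg]
      simp
    · rw [if_neg hk.ne', decide_eq_true (show -(k : ℤ) < 0 by omega)]
  · obtain ⟨k, rfl⟩ : ∃ k : ℕ, n = k := ⟨n.natAbs, by omega⟩
    simp only [Registers.atRow, Registers.flags, h, decide_false, Bool.false_eq_true, if_false]
    rw [exec_incZigzag, decide_eq_false (show ¬ (k : ℤ) + 1 < 0 by omega)]
    rfl

/-- Decrement the row. -/
def decRow (q : M.Instr Λ) : M.Instr Λ :=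
  cases (fun a => a.neg) (incZigzag q)
    (ifRowZero (setNeg true (incZigzag q)) (decZigzag q))

theorem exec_decRow (n : ℤ) : exec (decRow q) ((r.atRow n).memory M) =
    exec q (({ r with cur := none }.atRow (n - 1)).memory M) := by
  rw [decRow, exec_cases_memory]
  by_cases h : n < 0
  · obtain ⟨k, rfl⟩ : ∃ k : ℕ, n = -(k : ℕ) := ⟨n.natAbs, by omega⟩
    have e : (-(k : ℤ) - 1) = -((k + 1 : ℕ) : ℤ) := by omega
    simp only [Registers.atRow, Registers.flags, h, decide_true, if_true]
    rw [exec_incZigzag, e, decide_eq_true (show -((k + 1 : ℕ) : ℤ) < 0 by omega)]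
    simp only [Int.natAbs_neg, Int.natAbs_natCast]
    rfl
  · have h' : (r.atRow n).flags.neg = false := by simpa [Registers.atRow, Registers.flags] using h
    rw [h', if_neg (by simp), exec_ifRowZero_atRow]
    by_cases h0 : n = 0
    · subst h0
      rw [if_pos rfl, exec_setNeg, exec_incZigzag]
      rfl
    · obtain ⟨k, rfl⟩ : ∃ k : ℕ, n = (k + 1 : ℕ) := ⟨n.natAbs - 1, by omega⟩
      have e : ((k + 1 : ℕ) : ℤ) - 1 = (k : ℤ) := by omega
      rw [if_neg h0, exec_decZigzag, e]
      simp only [Registers.atRow, Int.natAbs_natCast, Zigzag.prev_ofNat_succ, h,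
        decide_eq_false (show ¬ (k : ℤ) < 0 by omega), decide_false]

/-- Change the sign of the row. -/
def negRow (q : M.Instr Λ) : M.Instr Λ :=
  ifRowZero q (modify (fun a => { a with neg := !a.neg }) q)

theorem exec_negRow (n : ℤ) : exec (negRow q) ((r.atRow n).memory M) =
    exec q (({ r with cur := none }.atRow (-n)).memory M) := by
  rw [negRow, exec_ifRowZero_atRow]
  by_cases h0 : n = 0
  · rw [if_pos h0, h0, neg_zero]
  · rw [if_neg h0]
    unfold Registers.memory
    rw [exec_modify]
    have e : decide (-n < 0) = !decide (n < 0) := by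
      rw [← decide_not, decide_eq_decide]; omega
    simp only [Registers.atRow, Registers.flags, Int.natAbs_neg, e]
    congr 1

/-! ### Applying one letter to the stored trace. -/

/-- Apply the reflection of the columns to the stored trace. -/
def flipTrace (q : M.Instr Λ) : M.Instr Λ := negCtr 0 (negCtr 2 (flipOrientation q))

theorem update_vec_zero (x y z u : ℤ) : Function.update ![x, y, z] 0 u = ![u, y, z] := by
  funext i
  fin_cases i <;> rfl

theorem update_vec_one (x y z u : ℤ) : Function.update ![x, y, z] 1 u = ![x, u, z] := by
  funext i
  fin_cases i <;> rfl

theorem update_vec_two (x y z u : ℤ) : Function.update ![x, y, z] 2 u = ![x, y, u] := by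
  funext i
  fin_cases i <;> rfl

theorem exec_flipTrace (input done : List (Fin 4 × Bool)) (cur : Option (Fin 4 × Bool))
    (a : Trace) : exec (flipTrace q) ((Registers.ofTrace input done cur a).memory M) =
      exec q ((Registers.ofTrace input done none a.flip).memory M) := by
  rw [flipTrace, exec_negCtr, exec_negCtr, exec_flipOrientation]
  simp only [Registers.ofTrace, Trace.flip, update_vec_zero, update_vec_two]
  rfl

def finish : M.Instr Bool := forget (jump false)

def isLetter (k : Fin 4) (a : Flags) : Bool := a.cur.any fun p => p.1 == k

def isPositive (a : Flags) : Bool := a.cur.any fun p => p.2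

/-- Apply the inverse of the letter popped last to the stored trace, or jump to `true` if a letter
has to be written. -/
def letterStmt (M : NTM (Fin 2 × Bool)) : M.Instr Bool :=
  cases (isLetter 0)
    (cases isPositive (decCtr 1 (decRow finish)) (incCtr 1 (incRow finish)))
    (cases (isLetter 1)
      (cases isPositive (ifRowZero (decCtr 0 (decCtr 2 finish)) finish)
        (ifRowZero (incCtr 0 (incCtr 2 finish)) finish))
      (cases (isLetter 2) (ifRowZero (flipTrace finish) finish)
        (ifTargetZero (ifCtrZero 0 (flipTrace finish) (jump true)) finish)))

theorem exec_finish : exec finish (r.memory M) =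
    Cfg.of (some false) ({ r with cur := none }.memory M) := rfl

theorem exec_letterStmt (input done : List (Fin 4 × Bool)) (p : Fin 4 × Bool) (a : Trace)
    (h : p.1 = 3 → rowIndex a.n = none ∨ a.m = 0) :
    exec M.letterStmt ((Registers.ofTrace input done (some p) a).memory M) =
      Cfg.of (some false) ((Registers.ofTrace input done none (a.step p)).memory M) := by
  obtain ⟨k, b⟩ := p
  rw [letterStmt, exec_cases_memory]
  obtain rfl | rfl | rfl | rfl := fin_four_cases k
  · rw [if_pos (by simp [isLetter, Registers.flags, Registers.ofTrace]), exec_cases_memory]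
    cases b
    · rw [if_neg (by simp [isPositive, Registers.flags, Registers.ofTrace]), exec_incCtr]
      refine (exec_incRow finish { Registers.ofTrace input done none a with
        ctr := Function.update ![a.m, a.j, a.d] 1 (a.j + 1) } a.n).trans ?_
      rw [exec_finish, update_vec_one]
      rfl
    · rw [if_pos (by simp [isPositive, Registers.flags, Registers.ofTrace]), exec_decCtr]
      refine (exec_decRow finish { Registers.ofTrace input done none a with
        ctr := Function.update ![a.m, a.j, a.d] 1 (a.j - 1) } a.n).trans ?_
      rw [exec_finish, update_vec_one]
      rfl
  · rw [if_neg (by simp [isLetter, Registers.flags, Registers.ofTrace]), exec_cases_memory,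
      if_pos (by simp [isLetter, Registers.flags, Registers.ofTrace]), exec_cases_memory]
    cases b
    · rw [if_neg (by simp [isPositive, Registers.flags, Registers.ofTrace])]
      refine (exec_ifRowZero_atRow _ _ (Registers.ofTrace input done _ a) a.n).trans ?_
      by_cases hn : a.n = 0
      · rw [if_pos hn, exec_incCtr, exec_incCtr, exec_finish]
        simp only [Registers.ofTrace, Registers.atRow, update_vec_zero, update_vec_two,
          Trace.step, hn, Trace.disp]
        rfl
      · rw [if_neg hn, exec_finish]
        simp only [Trace.step, hn]
        rfl
    · rw [if_pos (by simp [isPositive, Registers.flags, Registers.ofTrace])]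
      refine (exec_ifRowZero_atRow _ _ (Registers.ofTrace input done _ a) a.n).trans ?_
      by_cases hn : a.n = 0
      · rw [if_pos hn, exec_decCtr, exec_decCtr, exec_finish]
        simp only [Registers.ofTrace, Registers.atRow, update_vec_zero, update_vec_two,
          Trace.step, hn, Trace.disp]
        rfl
      · rw [if_neg hn, exec_finish]
        simp only [Trace.step, hn]
        rfl
  · rw [if_neg (by simp [isLetter, Registers.flags, Registers.ofTrace]), exec_cases_memory,
      if_neg (by simp [isLetter, Registers.flags, Registers.ofTrace]), exec_cases_memory,
      if_pos (by simp [isLetter, Registers.flags, Registers.ofTrace])]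
    refine (exec_ifRowZero_atRow _ _ (Registers.ofTrace input done _ a) a.n).trans ?_
    by_cases hn : a.n = 0
    · rw [if_pos hn]
      refine (exec_flipTrace finish input done none a).trans ?_
      rw [exec_finish]
      simp only [Trace.step, hn]
      rfl
    · rw [if_neg hn, exec_finish]
      simp only [Trace.step, hn]
      rfl
  · rw [if_neg (by simp [isLetter, Registers.flags, Registers.ofTrace]), exec_cases_memory,
      if_neg (by simp [isLetter, Registers.flags, Registers.ofTrace]), exec_cases_memory,
      if_neg (by simp [isLetter, Registers.flags, Registers.ofTrace]), exec_ifTargetZero]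
    by_cases ht : (Zigzag.ofNat a.n.natAbs).target = 0
    · have hr : rowIndex a.n = some (Zigzag.ofNat a.n.natAbs).source := if_pos ht
      have hm : a.m = 0 := (h rfl).resolve_left (by simp [hr])
      refine (congrArg (exec · _) (if_pos ht)).trans ?_
      rw [exec_ifCtrZero]
      refine (congrArg (exec · _) (if_pos hm)).trans ?_
      refine (exec_flipTrace finish input done none a).trans ?_
      rw [exec_finish]
      simp only [Trace.step, hr, Trace.emit, hm]
      rfl
    · have hr : rowIndex a.n = none := if_neg ht
      refine (congrArg (exec · _) (if_neg ht)).trans ?_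
      rw [exec_finish]
      simp only [Trace.step, hr]
      rfl

theorem exec_letterStmt_true (input done : List (Fin 4 × Bool)) (b : Bool) (a : Trace) (i : ℕ)
    (hi : rowIndex a.n = some i) (hm : a.m ≠ 0) :
    exec M.letterStmt ((Registers.ofTrace input done (some (3, b)) a).memory M) =
      Cfg.of (some true) ((Registers.ofTrace input done none a).memory M) := by
  have ht : (Zigzag.ofNat a.n.natAbs).target = 0 := by
    unfold rowIndex at hi
    split_ifs at hi with h
    exact h
  rw [letterStmt, exec_cases_memory,
    if_neg (by simp [isLetter, Registers.flags, Registers.ofTrace]), exec_cases_memory,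
    if_neg (by simp [isLetter, Registers.flags, Registers.ofTrace]), exec_cases_memory,
    if_neg (by simp [isLetter, Registers.flags, Registers.ofTrace]), exec_ifTargetZero]
  refine (congrArg (exec · _) (if_pos ht)).trans ?_
  rw [exec_ifCtrZero]
  exact congrArg (exec · _) (if_neg hm)

/-- Move the counter that decreases to the auxiliary counter and write a letter for each unit. -/
def descendStmt (M : NTM (Fin 2 × Bool)) : M.Instr Bool :=
  cases (fun a => a.dir)
    (pop .snd (cases (fun a => a.cur.isSome) (push .aux (write (1, false) (jump true)))
      (jump false)))
    (pop .fst (cases (fun a => a.cur.isSome) (push .aux (write (1, false) (jump true)))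
      (jump false)))

/-- The counter being emptied holds the index in unary, and the auxiliary counter keeps it for
restoring. Letters are pushed, so the code of a generator is written from its right end, beginning
with the block of `b⁻¹`. -/
theorem spec_descend (x t : ℕ) (cur : Option (Fin 4 × Bool)) (u : List (Fin 2 × Bool)) :
    (Program.iterate M.descendStmt).Spec
      ({ r with z := r.z.withSource x, aux := t, cur := cur, out := u }.memory M) (x + 1) True
      ({ r with z := r.z.withSource 0, aux := t + x, cur := none,
                out := List.replicate x (1, false) ++ u }.memory M) := by
  obtain ⟨input, done, ⟨dir, a, b⟩, aux, ctr, cur', neg, f, out⟩ := r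
  induction x generalizing t cur u with
  | zero =>
    refine Program.spec_iterate_done ?_
    cases dir <;> simp [descendStmt, exec_cases_memory, exec_pop_fst, exec_pop_snd,
      Registers.flags, Zigzag.withSource, exec_jump]
  | succ x ih =>
    have := ih (t + 1) (some default) ((1, false) :: u)
    rw [show t + 1 + x = t + (x + 1) by omega, show List.replicate x ((1 : Fin 2), false) ++
      (1, false) :: u = List.replicate (x + 1) (1, false) ++ u by
        rw [List.replicate_succ', List.append_assoc]; rfl] at this
    refine Program.spec_iterate_step ?_ this
    cases dir <;> simp [descendStmt, exec_cases_memory, exec_pop_fst, exec_pop_snd, exec_push_aux,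
      exec_write_memory, Registers.flags, Zigzag.withSource, exec_jump]

/-- Write a letter that depends on the sign of the column. -/
def middleStmt (M : NTM (Fin 2 × Bool)) : M.Instr Bool :=
  cases (fun a => a.sg 0) (write (0, false) (jump false)) (write (0, true) (jump false))

/-- Move the auxiliary counter back, write a letter for each unit, and finally apply the reflection
of the columns. -/
def ascendStmt (M : NTM (Fin 2 × Bool)) : M.Instr Bool :=
  pop .aux (cases (fun a => a.cur.isSome)
    (cases (fun a => a.dir) (push .snd (write (1, true) (jump true)))
      (push .fst (write (1, true) (jump true))))
    (jump false))

theorem spec_ascend (x t : ℕ) (cur : Option (Fin 4 × Bool)) (u : List (Fin 2 × Bool)) :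
    (Program.iterate M.ascendStmt).Spec
      ({ r with z := r.z.withSource x, aux := t, cur := cur, out := u }.memory M) (t + 1) True
      ({ r with z := r.z.withSource (x + t), aux := 0, cur := none,
                out := List.replicate t (1, true) ++ u }.memory M) := by
  obtain ⟨input, done, ⟨dir, a, b⟩, aux, ctr, cur', neg, f, out⟩ := r
  induction t generalizing x cur u with
  | zero =>
    refine Program.spec_iterate_done ?_
    simp [ascendStmt, exec_cases_memory, exec_pop_aux, Registers.flags, exec_jump]
  | succ t ih =>
    have := ih (x + 1) (some default) ((1, true) :: u)
    rw [show x + 1 + t = x + (t + 1) by omega, show List.replicate t ((1 : Fin 2), true) ++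
      (1, true) :: u = List.replicate (t + 1) (1, true) ++ u by
        rw [List.replicate_succ', List.append_assoc]; rfl] at this
    refine Program.spec_iterate_step ?_ this
    cases dir <;> simp [ascendStmt, exec_cases_memory, exec_pop_aux, exec_push_fst, exec_push_snd,
      exec_write_memory, Registers.flags, Zigzag.withSource, exec_jump]

/-- Write the code of a letter `c i` or its inverse, and apply the reflection of the columns. -/
def emission (M : NTM (Fin 2 × Bool)) : Program M.StackSymbol (M.σ × Flags) :=
  (Program.iterate M.descendStmt).seq ((Program.iterate M.middleStmt).seq
    ((Program.iterate M.ascendStmt).seq (Program.iterate (flipTrace finish))))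

theorem spec_emission (input done : List (Fin 4 × Bool)) (a : Trace) (i : ℕ)
    (hi : rowIndex a.n = some i) (hm : a.m ≠ 0) :
    M.emission.Spec ((Registers.ofTrace input done none a).memory M)
      (i + 1 + (1 + (i + 1 + 1))) True
      ((Registers.ofTrace input done none { a.flip with out := a.emit i }).memory M) := by
  have hs : (Zigzag.ofNat a.n.natAbs).source = i := by
    unfold rowIndex at hi
    split_ifs at hi with h
    simpa using hi
  have hz : (Zigzag.ofNat a.n.natAbs).withSource i = Zigzag.ofNat a.n.natAbs := by
    rw [← hs, Zigzag.withSource_source]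
  set r := Registers.ofTrace input done none a with hr
  have h1 := spec_descend (M := M) r i 0 none (nu a.out)
  have h3 := spec_ascend (M := M) r 0 i none
    ((0, decide (0 < a.m)) :: (List.replicate i (1, false) ++ nu a.out))
  have h2 : exec M.middleStmt (Registers.memory M
      { r with z := r.z.withSource 0, aux := 0 + i, cur := none,
               out := List.replicate i (1, false) ++ nu a.out }) =
      Cfg.of (some false) (Registers.memory M
      { r with z := r.z.withSource 0, aux := i, cur := none,
               out := (0, decide (0 < a.m)) :: (List.replicate i (1, false) ++ nu a.out) }) := by
    rw [middleStmt, exec_cases_memory, zero_add]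
    by_cases h : a.m < 0
    · refine (congrArg (exec · _) (if_pos (decide_eq_true h))).trans ?_
      rw [exec_write_memory, decide_eq_false (by omega)]
      rfl
    · refine (congrArg (exec · _) (if_neg (ne_true_of_eq_false (decide_eq_false h)))).trans ?_
      rw [exec_write_memory, decide_eq_true (by omega)]
      rfl
  have h4 : exec (flipTrace finish) (Registers.memory M
      { r with z := r.z.withSource (0 + i), aux := 0, cur := none,
               out := List.replicate i (1, true) ++
                ((0, decide (0 < a.m)) :: (List.replicate i (1, false) ++ nu a.out)) }) =
      Cfg.of (some false)
        ((Registers.ofTrace input done none { a.flip with out := a.emit i }).memory M) := by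
    have e : ({ r with
        z := r.z.withSource (0 + i), aux := 0, cur := none,
        out := List.replicate i (1, true) ++ ((0, decide (0 < a.m)) ::
          (List.replicate i (1, false) ++ nu a.out)) } : Registers) =
        Registers.ofTrace input done none { a with out := a.emit i } := by
      simp only [hr, Registers.ofTrace, zero_add, hz, Trace.emit, if_neg hm, nu,
        List.flatMap_cons, nuLetter, List.append_assoc, List.cons_append, List.nil_append]
    rw [e, exec_flipTrace]
    rfl
  have h1' : { r with z := r.z.withSource i, aux := 0, cur := none, out := nu a.out } = r := by
    simp only [hr, Registers.ofTrace, hz]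
  rw [h1'] at h1
  exact (h1.seq fun _ => (Program.spec_iterate_done h2).seq fun _ => h3.seq fun _ =>
    Program.spec_iterate_done h4).congr (by simp)

/-- Apply the inverse of the letter popped last to the stored trace. -/
def applyLetter (M : NTM (Fin 2 × Bool)) : Program M.StackSymbol (M.σ × Flags) :=
  Program.when M.letterStmt M.emission

theorem spec_applyLetter (input done : List (Fin 4 × Bool)) (p : Fin 4 × Bool) (a : Trace) :
    M.applyLetter.Spec ((Registers.ofTrace input done (some p) a).memory M)
      (2 * a.n.natAbs + 5) True ((Registers.ofTrace input done none (a.step p)).memory M) := by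
  by_cases h : p.1 = 3 → rowIndex a.n = none ∨ a.m = 0
  · exact (Program.spec_when_false (exec_letterStmt input done p a h)).mono (by omega)
  · push Not at h
    obtain ⟨h3, hi, hm⟩ := h
    obtain ⟨k, b⟩ := p
    obtain rfl : k = 3 := h3
    obtain ⟨i, hi⟩ := Option.ne_none_iff_exists'.mp hi
    -- The index never exceeds the row, so writing a letter takes time linear in the row.
    have hle : i ≤ a.n.natAbs := by
      rw [rowIndex_eq_some_iff] at hi
      exact hi ▸ le_triangular i
    have := Program.spec_when_true (exec_letterStmt_true (M := M) input done b a i hi hm)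
      (spec_emission input done a i hi hm)
    have e : a.step (3, b) = { a.flip with out := a.emit i } := by simp [Trace.step, hi]
    rw [e]
    exact this.mono (by omega)

end NTM

/-! ### The trial of one starting point. -/

namespace Trace

theorem natAbs_n_step_le (a : Trace) (p : Fin 4 × Bool) :
    (a.step p).n.natAbs ≤ a.n.natAbs + 1 := by
  apply step_cases (motive := fun b => b.n.natAbs ≤ a.n.natAbs + 1) a p
  · simp only [disp]; split_ifs <;> omega
  all_goals intros; simp [flip]

theorem length_out_run_le (w : List (Fin 4 × Bool)) (a : Trace) (N : ℕ)
    (hN : a.n.natAbs + w.length ≤ N) :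
    (nu (run w a).out).length ≤ (nu a.out).length + w.length * (2 * N + 1) := by
  induction w generalizing a with
  | nil => simp
  | cons p w ih =>
    simp only [List.length_cons] at hN
    have h1 := natAbs_n_step_le a p
    have h2 := ih (a.step p) (by omega)
    have h3 : (nu (a.step p).out).length ≤ (nu a.out).length + (2 * N + 1) := by
      apply step_cases (motive := fun b => (nu b.out).length ≤ (nu a.out).length + (2 * N + 1)) a p
      · simp
      · simp
      · simp [flip]
      · intro i hi
        rw [rowIndex_eq_some_iff] at hi
        have := le_triangular i
        simp only [emit]
        split_ifs
        · omega
        · simp [nu, nuLetter]; omega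
      · simp
    rw [run_cons, List.length_cons, add_mul]
    omega

end Trace

namespace NTM

variable {M : NTM (Fin 2 × Bool)} (r : Registers)

def readStmt (M : NTM (Fin 2 × Bool)) : M.Instr Bool :=
  pop .input (cases (fun a => a.cur.isSome) (pushCur .done (jump true)) (jump false))

/-- Follow the trace of the input. -/
def follow (M : NTM (Fin 2 × Bool)) : Program M.StackSymbol (M.σ × Flags) :=
  Program.loop M.readStmt M.applyLetter

theorem spec_follow (w done : List (Fin 4 × Bool)) (a : Trace) (N : ℕ)
    (hN : a.n.natAbs + w.length ≤ N) :
    M.follow.Spec ((Registers.ofTrace w done none a).memory M) (w.length * (2 * N + 6) + 1) True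
      ((Registers.ofTrace [] (w.reverse ++ done) none (Trace.run w a)).memory M) := by
  induction w generalizing done a with
  | nil =>
    refine (Program.spec_loop_done ?_).mono (by omega)
    simp [readStmt, exec_pop_input, exec_cases_memory, Registers.ofTrace, Registers.flags,
      exec_jump]
    rfl
  | cons p w ih =>
    simp only [List.length_cons] at hN ⊢
    have h1 := Trace.natAbs_n_step_le a p
    have ht : exec M.readStmt ((Registers.ofTrace (p :: w) done none a).memory M) =
        Cfg.of (some true) ((Registers.ofTrace w (p :: done) (some p) a).memory M) := by
      simp [readStmt, exec_pop_input, exec_pushCur_done, exec_cases_memory, Registers.ofTrace,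
        Registers.flags, exec_jump]
    have := Program.spec_loop_step ht (spec_applyLetter w (p :: done) p a)
      fun _ => ih (p :: done) (a.step p) (by omega)
    simp only [List.reverse_cons, List.append_assoc, List.singleton_append]
    refine (this.congr (by simp)).mono ?_
    rw [add_mul]
    omega

def rewindStmt (M : NTM (Fin 2 × Bool)) : M.Instr Bool :=
  pop .done (cases (fun a => a.cur.isSome) (pushCur .input (jump true)) (jump false))

theorem spec_rewind (w done : List (Fin 4 × Bool)) (cur : Option (Fin 4 × Bool)) :
    (Program.iterate M.rewindStmt).Spec
      ({ r with input := w, done := done, cur := cur }.memory M) (done.length + 1) True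
      ({ r with input := done.reverse ++ w, done := [], cur := none }.memory M) := by
  induction done generalizing w cur with
  | nil =>
    refine Program.spec_iterate_done ?_
    simp [rewindStmt, exec_pop_done, exec_cases_memory, Registers.flags, exec_jump]
  | cons p done ih =>
    have := ih (p :: w) (some p)
    simp only [List.reverse_cons, List.append_assoc, List.singleton_append]
    refine Program.spec_iterate_step ?_ this
    simp [rewindStmt, exec_pop_done, exec_pushCur_input, exec_cases_memory, Registers.flags,
      exec_jump]

/-- Test whether the stored trace is closed. -/
def closedStmt (M : NTM (Fin 2 × Bool)) : M.Instr Bool :=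
  ifCtrZero 1 (ifCtrZero 2 (.goto fun v => v.2.f) (jump false)) (jump false)

open Classical in
theorem exec_closedStmt (input done : List (Fin 4 × Bool)) (a : Trace) :
    exec M.closedStmt ((Registers.ofTrace input done none a).memory M) =
      Cfg.of (some (decide a.Closed)) ((Registers.ofTrace input done none a).memory M) := by
  have e1 : (Registers.ofTrace input done none a).ctr 1 = a.j := rfl
  have e2 : (Registers.ofTrace input done none a).ctr 2 = a.d := rfl
  rw [closedStmt, exec_ifCtrZero, e1]
  by_cases hj : a.j = 0
  · rw [if_pos hj, exec_ifCtrZero]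
    simp only [e2]
    by_cases hd : a.d = 0
    · rw [if_pos hd]
      have : decide a.Closed = a.f := by simp [Trace.Closed, hj, hd]
      rw [this]
      rfl
    · rw [if_neg hd, decide_eq_false (fun h => hd h.2.1)]
      rfl
  · rw [if_neg hj, decide_eq_false (fun h => hj h.1)]
    rfl

/-- The condition that is checked for each row and each column. -/
def Passes (M : NTM (Fin 2 × Bool)) (w : List (Fin 4 × Bool)) (n m : ℤ) : Prop :=
  (Trace.run w (Trace.start n m)).Closed ∧ M.Accepts (nu (Trace.run w (Trace.start n m)).out)

noncomputable section

/-- Check one row and one column. -/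
def trial (M : NTM (Fin 2 × Bool)) : Program M.StackSymbol (M.σ × Flags) :=
  M.follow.seq ((Program.assert M.closedStmt).seq (M.query.seq (Program.iterate M.rewindStmt)))

/-- The memory before the trial of a row and a column. -/
def trialMemory (M : NTM (Fin 2 × Bool)) (w : List (Fin 4 × Bool)) (n m : ℤ) : M.Extended :=
  (Registers.ofTrace w [] none (Trace.start n m)).memory M

/-- The test for closing up has a second use: it guarantees that row, column, displacement,
translation and orientation are back at their initial values. So emptying the stacks of `M` and
rewinding the input restores the memory, and no copy of the start is kept. -/
theorem spec_trial {C : ℕ} (hC : ∀ l, ∀ q ∈ M.prog l, q.size ≤ C) (w : List (Fin 4 × Bool))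
    (n m : ℤ) (N : ℕ) (hN : n.natAbs + w.length ≤ N) {T : ℕ}
    (hT : ∀ u : List (Fin 2 × Bool), u.length ≤ w.length * (2 * N + 1) →
      ∀ n c, M.StepsIn n (M.init u) c → n ≤ T) :
    M.trial.Spec (M.trialMemory w n m)
      (w.length * (2 * N + 6) + 1 + (2 + (T + 1 + (2 + (w.length * (2 * N + 1) + T * C + 1)) +
        (w.length + 1)))) (M.Passes w n m) (M.trialMemory w n m) := by
  classical
  set b := Trace.run w (Trace.start n m) with hb
  have hlen : (nu b.out).length ≤ w.length * (2 * N + 1) := by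
    refine (Trace.length_out_run_le w (Trace.start n m) N hN).trans ?_
    simp [Trace.start, nu]
  have h1 := spec_follow (M := M) w [] (Trace.start n m) N hN
  have h2 := Program.spec_assert (exec_closedStmt (M := M) [] (w.reverse ++ []) b)
  refine (h1.seq fun _ => (h2.congr decide_eq_true_iff).seq fun hcl =>
    ((M.spec_query hC _ _ (nu b.out) (hT _ hlen)).mono ?_).seq (ψ := True) fun _ => ?_).congr ?_
  · omega
  · have h3 := spec_rewind (M := M) (Registers.ofTrace w [] none (Trace.start n m)) []
      (w.reverse ++ []) none
    simp only [List.append_nil, List.reverse_reverse, List.length_reverse] at h3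
    have hn : b.n = n := by
      have := Trace.n_run w (Trace.start n m)
      rw [← hb, hcl.1] at this
      simpa [Trace.start] using this
    have hm : b.m = m := by
      have := Trace.m_run w n m
      rw [← hb, hcl.2.1, hcl.2.2] at this
      simpa using this
    have e : M.extend { (Registers.ofTrace [] (w.reverse ++ []) none b).flags with cur := none }
        (Registers.ofTrace [] (w.reverse ++ []) none b).work (M.initMemory []) =
        ({ Registers.ofTrace w [] none (Trace.start n m) with
          input := [], done := w.reverse, cur := none }.memory M) := by
      have e' : Registers.ofTrace [] (w.reverse ++ []) none { b with out := [] } =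
          { Registers.ofTrace w [] none (Trace.start n m) with
            input := [], done := w.reverse, cur := none } := by
        simp only [Registers.ofTrace, Trace.start, hn, hm, hcl.1, hcl.2.1, hcl.2.2,
          List.append_nil]
        rfl
      rw [← e']
      rfl
    rw [e]
    exact h3
  · simp [Passes, ← hb]

end

end NTM

/-! ### Loops over columns and rows, and the polynomial bound. -/

theorem polynomial_eval_le_eval (p : Polynomial ℕ) {m n : ℕ} (h : m ≤ n) :
    p.eval m ≤ p.eval n := by
  rw [Polynomial.eval_eq_sum_range, Polynomial.eval_eq_sum_range]
  gcongr

noncomputable section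

namespace NTM

variable {M : NTM (Fin 2 × Bool)}

/-- Run a program, execute a statement, and do both once more. -/
def both (P : Program M.StackSymbol (M.σ × Flags)) (t : M.Instr Bool) :
    Program M.StackSymbol (M.σ × Flags) :=
  P.seq ((Program.iterate t).seq (P.seq (Program.iterate t)))

theorem spec_both {P : Program M.StackSymbol (M.σ × Flags)} {t : M.Instr Bool}
    {x y : M.Extended} {T : ℕ} {φ ψ : Prop} (hx : P.Spec x T φ x) (hy : P.Spec y T ψ y)
    (hxy : exec t x = Cfg.of (some false) y) (hyx : exec t y = Cfg.of (some false) x) :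
    (both P t).Spec x (2 * T + 2) (φ ∧ ψ) x :=
  ((hx.seq fun _ => (Program.spec_iterate_done hxy).seq fun _ => hy.seq fun _ =>
    Program.spec_iterate_done hyx).congr (by simp)).mono (by omega)

def columnTest (M : NTM (Fin 2 × Bool)) : M.Instr Bool :=
  ifCtrZero 0 (jump false) (shrinkCtr 0 false (jump true))

theorem exec_negColumn (w : List (Fin 4 × Bool)) (n m : ℤ) :
    exec (negCtr 0 finish) (M.trialMemory w n m) =
      Cfg.of (some false) (M.trialMemory w n (-m)) := by
  rw [trialMemory, exec_negCtr, exec_finish]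
  simp only [Registers.ofTrace, Trace.start, update_vec_zero, trialMemory]
  rfl

theorem exec_columnTest_zero (w : List (Fin 4 × Bool)) (n : ℤ) :
    exec M.columnTest (M.trialMemory w n 0) =
      Cfg.of (some false) (M.trialMemory w n 0) := by
  rw [trialMemory, columnTest, exec_ifCtrZero]
  rfl

theorem exec_columnTest_succ (w : List (Fin 4 × Bool)) (n : ℤ) (k : ℕ) :
    exec M.columnTest (M.trialMemory w n (k + 1 : ℕ)) =
      Cfg.of (some true) (M.trialMemory w n k) := by
  rw [trialMemory, columnTest, exec_ifCtrZero]
  refine (congrArg (exec · _) (if_neg (show ((k + 1 : ℕ) : ℤ) ≠ 0 by omega))).trans ?_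
  rw [exec_shrinkCtr _ _ _ _ k (by simp [Registers.ofTrace, Trace.start]; omega)
    (fun _ => (decide_eq_false (by omega)).symm), exec_jump]
  simp only [Registers.ofTrace, Trace.start, update_vec_zero, trialMemory]
  rfl

/-- Check all columns of a row, starting below the current one. -/
def columnLoop (M : NTM (Fin 2 × Bool)) : Program M.StackSymbol (M.σ × Flags) :=
  Program.loop M.columnTest (both M.trial (negCtr 0 finish))

/-- The test decrements the column before the trials, so they run over `± (k - 1)` down to `± 0`;
column `0` is tried twice, which does no harm. -/
theorem spec_columnLoop (w : List (Fin 4 × Bool)) (n : ℤ) (T k : ℕ)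
    (h : ∀ m, M.trial.Spec (M.trialMemory w n m) T (M.Passes w n m) (M.trialMemory w n m)) :
    M.columnLoop.Spec (M.trialMemory w n k) (k * (2 * T + 3) + 1)
      (∀ m : ℤ, m.natAbs < k → M.Passes w n m) (M.trialMemory w n 0) := by
  induction k with
  | zero =>
    refine ((Program.spec_loop_done (exec_columnTest_zero w n)).mono (by omega)).congr ?_
    simp
  | succ k ih =>
    have hb := spec_both (h k) (h (-k)) (exec_negColumn w n k)
      (by simpa using exec_negColumn w n (-k))
    refine ((Program.spec_loop_step (exec_columnTest_succ w n k) hb fun _ => ih).mono ?_).congr ?_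
    · rw [add_mul]; omega
    · constructor
      · rintro ⟨⟨h1, h2⟩, h3⟩ m hm
        rcases (show m.natAbs < k ∨ m = k ∨ m = -k by omega) with hm | rfl | rfl
        · exact h3 m hm
        · exact h1
        · exact h2
      · intro h
        exact ⟨⟨h _ (by omega), h _ (by omega)⟩, fun m hm => h m (by omega)⟩

def fillColumnStmt (M : NTM (Fin 2 × Bool)) : M.Instr Bool :=
  pop .input (cases (fun a => a.cur.isSome) (pushCur .done (incCtr 0 (jump true))) (jump false))

theorem spec_fillColumn (w done : List (Fin 4 × Bool)) (n m : ℤ) (cur : Option (Fin 4 × Bool)) :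
    (Program.iterate M.fillColumnStmt).Spec
      ((Registers.ofTrace w done cur (Trace.start n m)).memory M) (w.length + 1) True
      ((Registers.ofTrace [] (w.reverse ++ done) none (Trace.start n (m + w.length))).memory M)
    := by
  induction w generalizing done m cur with
  | nil =>
    refine Program.spec_iterate_done ?_
    simp [fillColumnStmt, exec_pop_input, exec_cases_memory, Registers.ofTrace, Registers.flags,
      exec_jump]
  | cons p w ih =>
    have := ih (p :: done) (m + 1) none
    rw [show m + 1 + w.length = m + (p :: w).length by simp; ring] at this
    simp only [List.reverse_cons, List.append_assoc, List.singleton_append]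
    refine Program.spec_iterate_step ?_ this
    simp [fillColumnStmt, exec_pop_input, exec_pushCur_done, exec_cases_memory, Registers.ofTrace,
      Registers.flags, exec_jump, exec_incCtr, Trace.start, update_vec_zero]
    rfl

/-- Check all columns of a row. -/
def columns (M : NTM (Fin 2 × Bool)) : Program M.StackSymbol (M.σ × Flags) :=
  (Program.iterate M.fillColumnStmt).seq ((Program.iterate M.rewindStmt).seq
    ((Program.iterate (incCtr 0 (incCtr 0 finish))).seq M.columnLoop))

theorem spec_columns (w : List (Fin 4 × Bool)) (n : ℤ) (T : ℕ)
    (h : ∀ m, M.trial.Spec (M.trialMemory w n m) T (M.Passes w n m) (M.trialMemory w n m)) :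
    M.columns.Spec (M.trialMemory w n 0)
      (w.length + 1 + (w.length + 1 + (1 + ((w.length + 2) * (2 * T + 3) + 1))))
      (∀ m : ℤ, m.natAbs ≤ w.length + 1 → M.Passes w n m) (M.trialMemory w n 0) := by
  have h1 := spec_fillColumn (M := M) w [] n 0 none
  have h2 := spec_rewind (M := M) (Registers.ofTrace w [] none (Trace.start n (0 + w.length))) []
    (w.reverse ++ []) none
  simp only [List.append_nil, List.reverse_reverse, List.length_reverse] at h1 h2
  have h3 : exec (incCtr 0 (incCtr 0 finish)) (M.trialMemory w n (0 + w.length)) =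
      Cfg.of (some false) (M.trialMemory w n (w.length + 2 : ℕ)) := by
    rw [trialMemory, exec_incCtr, exec_incCtr, exec_finish]
    simp only [Registers.ofTrace, Trace.start, update_vec_zero, trialMemory]
    have : (0 + w.length + 1 + 1 : ℤ) = (w.length + 2 : ℕ) := by push_cast; ring
    rw [← this, zero_add]
    rfl
  refine (h1.seq fun _ => h2.seq fun _ => (Program.spec_iterate_done h3).seq fun _ =>
    spec_columnLoop w n T (w.length + 2) h).congr ?_
  simp only [true_and]
  exact forall_congr' fun m => ⟨fun h hm => h (by omega), fun h hm => h (by omega)⟩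

def rowTest (M : NTM (Fin 2 × Bool)) : M.Instr Bool :=
  ifRowZero (jump false) (decRow (jump true))

theorem exec_negRow_finish (w : List (Fin 4 × Bool)) (n : ℤ) :
    exec (negRow finish) (M.trialMemory w n 0) =
      Cfg.of (some false) (M.trialMemory w (-n) 0) :=
  (exec_negRow finish (Registers.ofTrace w [] none (Trace.start n 0)) n).trans (exec_finish _)

theorem exec_rowTest_zero (w : List (Fin 4 × Bool)) :
    exec M.rowTest (M.trialMemory w 0 0) = Cfg.of (some false) (M.trialMemory w 0 0) :=
  exec_ifRowZero_atRow _ _ (Registers.ofTrace w [] none (Trace.start 0 0)) 0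

theorem exec_rowTest_succ (w : List (Fin 4 × Bool)) (k : ℕ) :
    exec M.rowTest (M.trialMemory w (k + 1 : ℕ) 0) =
      Cfg.of (some true) (M.trialMemory w k 0) := by
  refine (exec_ifRowZero_atRow _ _ (Registers.ofTrace w [] none (Trace.start (k + 1 : ℕ) 0))
    (k + 1 : ℕ)).trans ?_
  refine (congrArg (exec · _) (if_neg (show ((k + 1 : ℕ) : ℤ) ≠ 0 by omega))).trans ?_
  rw [exec_decRow, show ((k + 1 : ℕ) : ℤ) - 1 = k by omega]
  rfl

/-- Check all rows, starting below the current one. -/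
def rowLoop (M : NTM (Fin 2 × Bool)) : Program M.StackSymbol (M.σ × Flags) :=
  Program.loop M.rowTest (both M.columns (negRow finish))

theorem spec_rowLoop (w : List (Fin 4 × Bool)) (T k : ℕ) (φ : ℤ → Prop)
    (h : ∀ n : ℤ, n.natAbs < k →
      M.columns.Spec (M.trialMemory w n 0) T (φ n) (M.trialMemory w n 0)) :
    M.rowLoop.Spec (M.trialMemory w k 0) (k * (2 * T + 3) + 1)
      (∀ n : ℤ, n.natAbs < k → φ n) (M.trialMemory w 0 0) := by
  induction k with
  | zero =>
    refine ((Program.spec_loop_done (exec_rowTest_zero w)).mono (by omega)).congr ?_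
    simp
  | succ k ih =>
    have hb := spec_both (h k (by omega)) (h (-k) (by omega)) (exec_negRow_finish w k)
      (by simpa using exec_negRow_finish w (-k))
    refine ((Program.spec_loop_step (exec_rowTest_succ w k) hb fun _ =>
      ih fun n hn => h n (by omega)).mono ?_).congr ?_
    · rw [add_mul]; omega
    · constructor
      · rintro ⟨⟨h1, h2⟩, h3⟩ n hn
        rcases (show n.natAbs < k ∨ n = k ∨ n = -k by omega) with hn | rfl | rfl
        · exact h3 n hn
        · exact h1
        · exact h2
      · intro h
        exact ⟨⟨h _ (by omega), h _ (by omega)⟩, fun n hn => h n (by omega)⟩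

/-- Two units per input letter, and four more in `decider`, produce the counters `(2 * L + 4, 0)`,
where `L` is the length of the input. This is the zigzag code of `triangular (2 * L + 4)`, so a
quadratic row number is set up in linear time. -/
def fillRowStmt (M : NTM (Fin 2 × Bool)) : M.Instr Bool :=
  pop .input (cases (fun a => a.cur.isSome)
    (pushCur .done (push .fst (push .fst (jump true)))) (jump false))

theorem spec_fillRow (r : Registers) (w done : List (Fin 4 × Bool)) (x : ℕ)
    (cur : Option (Fin 4 × Bool)) :
    (Program.iterate M.fillRowStmt).Spec
      ({ r with input := w, done := done, z := ⟨false, x, 0⟩, cur := cur }.memory M)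
      (w.length + 1) True
      ({ r with input := [], done := w.reverse ++ done, z := ⟨false, x + 2 * w.length, 0⟩,
                cur := none }.memory M) := by
  induction w generalizing done x cur with
  | nil =>
    refine Program.spec_iterate_done ?_
    simp [fillRowStmt, exec_pop_input, exec_cases_memory, Registers.flags, exec_jump]
  | cons p w ih =>
    have := ih (p :: done) (x + 2) (some p)
    rw [show x + 2 + 2 * w.length = x + 2 * (p :: w).length by simp; ring] at this
    simp only [List.reverse_cons, List.append_assoc, List.singleton_append]
    refine Program.spec_iterate_step ?_ this
    simp [fillRowStmt, exec_pop_input, exec_pushCur_done, exec_cases_memory, exec_push_fst,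
      Registers.flags, exec_jump]

/-- Check all rows and columns that matter for the input. -/
def decider (M : NTM (Fin 2 × Bool)) : Program M.StackSymbol (M.σ × Flags) :=
  (Program.iterate M.fillRowStmt).seq ((Program.iterate M.rewindStmt).seq
    ((Program.iterate (push .fst (push .fst (push .fst (push .fst finish))))).seq M.rowLoop))

theorem spec_decider (w : List (Fin 4 × Bool)) (T : ℕ) (φ : ℤ → Prop)
    (h : ∀ n : ℤ, n.natAbs < triangular (2 * w.length + 4) →
      M.columns.Spec (M.trialMemory w n 0) T (φ n) (M.trialMemory w n 0)) :
    M.decider.Spec (M.trialMemory w 0 0)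
      (w.length + 1 + (w.length + 1 + (1 + (triangular (2 * w.length + 4) * (2 * T + 3) + 1))))
      (∀ n : ℤ, n.natAbs < triangular (2 * w.length + 4) → φ n) (M.trialMemory w 0 0) := by
  set r := Registers.ofTrace w [] none (Trace.start 0 0) with hr
  have h1 := spec_fillRow (M := M) r w [] 0 none
  have h2 := spec_rewind (M := M) { r with z := ⟨false, 2 * w.length, 0⟩ } []
    (w.reverse ++ []) none
  simp only [List.append_nil, List.reverse_reverse, List.length_reverse, zero_add] at h1 h2
  have h3 : exec (push .fst (push .fst (push .fst (push .fst finish))))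
      ({ r with input := w, done := [], z := ⟨false, 2 * w.length, 0⟩, cur := none }.memory M) =
      Cfg.of (some false) (M.trialMemory w (triangular (2 * w.length + 4) : ℕ) 0) := by
    rw [exec_push_fst, exec_push_fst, exec_push_fst, exec_push_fst, exec_finish]
    have hz := Zigzag.ofNat_triangular_add (2 * w.length + 4) 0 (Nat.zero_le _)
    -- As `2 * w.length + 4` is even, the code has the direction `false` with which the machine
    -- starts.
    rw [if_pos (by omega)] at hz
    simp only [add_zero, Nat.sub_zero] at hz
    simp only [trialMemory, hr, Registers.ofTrace, Trace.start, Int.natAbs_natCast, hz]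
    rfl
  exact (h1.seq fun _ => h2.seq fun _ => (Program.spec_iterate_done h3).seq fun _ =>
    spec_rowLoop w T _ φ h).congr (by simp)

theorem deterministic_decider (h : M.Deterministic) : M.decider.Deterministic := by
  have iter {t : M.Instr Bool} : (Program.iterate t).Deterministic := Program.deterministic_iterate
  have hboth {P : Program M.StackSymbol (M.σ × Flags)} {t : M.Instr Bool} (hP : P.Deterministic) :
      (both P t).Deterministic := hP.seq (iter.seq (hP.seq iter))
  have hfollow : M.follow.Deterministic :=
    (Program.Deterministic.when (iter.seq (iter.seq (iter.seq iter)))).loop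
  have htrial : M.trial.Deterministic :=
    hfollow.seq (Program.deterministic_assert.seq ((M.deterministic_query h).seq iter))
  have hcolumns : M.columns.Deterministic :=
    iter.seq (iter.seq (iter.seq (hboth htrial).loop))
  exact iter.seq (iter.seq (iter.seq (hboth hcolumns).loop))

instance (k : M.K ⊕ WorkStack) : Finite (M.StackSymbol k) := by
  rcases k with k | k
  · exact M.finiteΓ k
  · exact inferInstanceAs (Finite (Fin 4 × Bool))

/-- The machine for the overgroup. -/
def overgroupMachine (M : NTM (Fin 2 × Bool)) : NTM (Fin 4 × Bool) where
  K := M.K ⊕ WorkStack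
  Γ := M.StackSymbol
  k₀ := .inr .input
  input := Function.Embedding.refl _
  Λ := M.decider.Λ
  main := M.decider.main
  σ := M.σ × Flags
  start := (M.start, ⟨none, false, false, true, fun _ => false⟩)
  -- A failed trial gets stuck and never halts, so halting alone means acceptance.
  accepting := Set.univ
  prog := M.decider.code

theorem init_overgroupMachine (w : List (Fin 4 × Bool)) :
    M.overgroupMachine.init w = Cfg.of (some M.decider.main) (M.trialMemory w 0 0) := by
  have hfl : (Registers.ofTrace w [] none (Trace.start 0 0)).flags =
      ⟨none, false, false, true, fun _ => false⟩ := by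
    simp only [Registers.flags, Registers.ofTrace, Trace.start, Flags.mk.injEq]
    refine ⟨trivial, rfl, by simp, trivial, ?_⟩
    funext i
    fin_cases i <;> rfl
  have hstk : (M.overgroupMachine.init w).stk = (M.trialMemory w 0 0).2 := by
    funext k
    rcases k with k | k
    · change Function.update (fun k => ([] : List (M.StackSymbol k)))
        (Sum.inr WorkStack.input : M.K ⊕ WorkStack) (w.map (Function.Embedding.refl _)) (.inl k) = _
      rw [Function.update_of_ne (by simp)]
      simp [trialMemory, Registers.memory, extend, join, initMemory, init, Registers.ofTrace,
        Trace.start, nu]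
    · by_cases hk : k = .input
      · subst hk
        change Function.update (fun k => ([] : List (M.StackSymbol k)))
          (Sum.inr WorkStack.input : M.K ⊕ WorkStack) (w.map (Function.Embedding.refl _)) (.inr .input) = _
        rw [Function.update_self]
        exact List.map_id _
      · change Function.update (fun k => ([] : List (M.StackSymbol k)))
          (Sum.inr WorkStack.input : M.K ⊕ WorkStack) (w.map (Function.Embedding.refl _)) (.inr k) = _
        rw [Function.update_of_ne (by simpa using hk)]
        cases k with
        | ctr i => fin_cases i <;> rfl
        | input => exact absurd rfl hk
        | _ => rfl
  have hvar : (M.overgroupMachine.init w).var = (M.trialMemory w 0 0).1 := by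
    simp only [trialMemory, Registers.memory, extend, hfl]
    rfl
  calc M.overgroupMachine.init w = ⟨some M.decider.main, (M.overgroupMachine.init w).var,
        (M.overgroupMachine.init w).stk⟩ := rfl
    _ = _ := by rw [hstk, hvar]; rfl

/-- The bounds of trial, column loop and row loop are nested polynomially: `R` is the number
`triangular (2 * L + 4)` that bounds the rows, `N` bounds the rows a trace can visit, `Q` the length
of a query and `p'` the time that `M` spends on it. -/
theorem exists_polynomial (hM : M.PolyTime) : ∃ P : Polynomial ℕ, ∀ w : List (Fin 4 × Bool),
    M.decider.Spec (M.trialMemory w 0 0) (P.eval w.length)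
      (∀ n : ℤ, n.natAbs < triangular (2 * w.length + 4) →
        ∀ m : ℤ, m.natAbs ≤ w.length + 1 → M.Passes w n m) (M.trialMemory w 0 0) := by
  obtain ⟨p, hp⟩ := hM
  obtain ⟨C, hC⟩ := M.exists_size_le
  let X : Polynomial ℕ := Polynomial.X
  let R : Polynomial ℕ := (X + 2) * (2 * X + 5)
  let N : Polynomial ℕ := R + X
  let Q : Polynomial ℕ := X * (2 * N + 1)
  let p' : Polynomial ℕ := p.comp Q
  let T₁ : Polynomial ℕ :=
    X * (2 * N + 6) + 1 + (2 + (p' + 1 + (2 + (Q + p' * Polynomial.C C + 1)) + (X + 1)))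
  let T₂ : Polynomial ℕ := X + 1 + (X + 1 + (1 + ((X + 2) * (2 * T₁ + 3) + 1)))
  let T₃ : Polynomial ℕ := X + 1 + (X + 1 + (1 + (R * (2 * T₂ + 3) + 1)))
  refine ⟨T₃, fun w => ?_⟩
  have hX : X.eval w.length = w.length := Polynomial.eval_X
  have hR : R.eval w.length = triangular (2 * w.length + 4) := by
    have := two_mul_triangular (2 * w.length + 4)
    have h2 : R.eval w.length = (w.length + 2) * (2 * w.length + 5) := by simp [R, X]
    nlinarith
  have hN : N.eval w.length = triangular (2 * w.length + 4) + w.length := by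
    simp only [N, Polynomial.eval_add, hR, hX]
  have hQ : Q.eval w.length = w.length * (2 * N.eval w.length + 1) := by simp [Q, X]
  have hp' : p'.eval w.length = p.eval (w.length * (2 * N.eval w.length + 1)) := by
    simp only [p', Polynomial.eval_comp, hQ]
  have h1 (n m : ℤ) (hn : n.natAbs < triangular (2 * w.length + 4)) :
      M.trial.Spec (M.trialMemory w n m) (T₁.eval w.length) (M.Passes w n m)
        (M.trialMemory w n m) := by
    refine (spec_trial hC w n m (N.eval w.length) (by omega) (T := p'.eval w.length)
      fun u hu k c hk => ?_).mono (le_of_eq ?_)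
    · rw [hp']
      exact (hp u k c hk).trans (polynomial_eval_le_eval p hu)
    · simp only [T₁, Polynomial.eval_add, Polynomial.eval_mul, Polynomial.eval_C, hX, hQ,
        Polynomial.eval_one, Polynomial.eval_ofNat]
  have h2 (n : ℤ) (hn : n.natAbs < triangular (2 * w.length + 4)) :=
    spec_columns w n (T₁.eval w.length) fun m => h1 n m hn
  refine (spec_decider w (T₂.eval w.length) _ fun n hn => (h2 n hn).mono (le_of_eq ?_)).mono
    (le_of_eq ?_)
  · simp only [T₂, Polynomial.eval_add, Polynomial.eval_mul, hX, Polynomial.eval_one,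
      Polynomial.eval_ofNat]
  · simp only [T₃, Polynomial.eval_add, Polynomial.eval_mul, hX, hR, Polynomial.eval_one,
      Polynomial.eval_ofNat]

theorem polyTime_overgroupMachine (hM : M.PolyTime) : M.overgroupMachine.PolyTime := by
  obtain ⟨P, hP⟩ := exists_polynomial hM
  refine ⟨P, fun w n c h => ?_⟩
  rw [init_overgroupMachine] at h
  exact stepsIn_le_of_terminates _ (hP w).1 n c h

theorem accepts_overgroupMachine_iff (hM : M.PolyTime) (w : List (Fin 4 × Bool)) :
    M.overgroupMachine.Accepts w ↔ ∀ n m : ℤ, n.natAbs < triangular (2 * w.length + 4) →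
      m.natAbs ≤ w.length + 1 → M.Passes w n m := by
  obtain ⟨P, hP⟩ := exists_polynomial hM
  have key := (hP w).2
  constructor
  · rintro ⟨n, ⟨_ | l, v, S⟩, h, hl, -⟩
    · rw [init_overgroupMachine] at h
      have := (key (v, S)).mp ((M.overgroupMachine.halts_iff_stepsIn _ (v, S)).mpr ⟨n, h⟩)
      exact fun n m hn hm => this.2 n hn m hm
    · simp at hl
  · intro h
    obtain ⟨n, hn⟩ := (M.overgroupMachine.halts_iff_stepsIn _ _).mp
      ((key (M.trialMemory w 0 0)).mpr ⟨rfl, fun n hn m hm => h n m hn hm⟩)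
    exact ⟨n, _, (init_overgroupMachine (M := M) w).symm ▸ hn, rfl, Set.mem_univ _⟩

end NTM

end

/-- The machine for the overgroup accepts its word problem. -/
theorem accepts_overgroupMachine_iff_mem {Γ : Type u} [Group Γ] (c : ℕ → Γ)
    {M : NTM (Fin 2 × Bool)} (hM : M.PolyTime)
    (hL : ∀ w, M.Accepts w ↔ w ∈ encodedWordProblem c) (w : List (Fin 4 × Bool)) :
    M.overgroupMachine.Accepts w ↔ w ∈ wordProblem (generator c) := by
  rw [NTM.accepts_overgroupMachine_iff hM, mem_wordProblem_generator_iff,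
    Trace.wordValue_eq_one_iff_bounded]
  simp only [NTM.Passes, hL, nu_mem_encodedWordProblem_iff]

theorem mainTheorem6 {Γ : Type u} [Group Γ] (c : ℕ → Γ)
    (hc : Subgroup.closure (Set.range c) = ⊤) :
    (InP (encodedWordProblem c) →
      ∃ (G : Type u) (_ : Group G) (φ : Γ →* G) (g : Fin 4 → G),
        Function.Injective φ ∧ Subgroup.closure (Set.range g) = ⊤ ∧ InP (wordProblem g)) ∧
    (InNP (encodedWordProblem c) →
      ∃ (G : Type u) (_ : Group G) (φ : Γ →* G) (g : Fin 4 → G),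
        Function.Injective φ ∧ Subgroup.closure (Set.range g) = ⊤ ∧ InNP (wordProblem g)) := by
  have hφ : Function.Injective (fibreMul.codRestrict (overgroup c) (fibreMul_mem c hc)) :=
    fun x y h => fibreMul_injective (congrArg Subtype.val h)
  constructor
  · rintro ⟨M, hdet, hpoly, hL⟩
    exact ⟨overgroup c, inferInstance, _, generator c, hφ, closure_generator c,
      M.overgroupMachine, NTM.deterministic_decider hdet, NTM.polyTime_overgroupMachine hpoly,
      accepts_overgroupMachine_iff_mem c hpoly hL⟩
  · rintro ⟨M, hpoly, hL⟩
    exact ⟨overgroup c, inferInstance, _, generator c, hφ, closure_generator c,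
      M.overgroupMachine, NTM.polyTime_overgroupMachine hpoly,
      accepts_overgroupMachine_iff_mem c hpoly hL⟩
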